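/- **Theorem 3.2.** Conventions. For an integer matrix $M$ with columns indexed by a finite set $I$, let $\mathrm{Ker}_{\mathbb Z}(M)=\{u\in\mathbb Z^{I}: Mu=0\}$. Its Graver basis $\mathcal Gr(M)$ is the set of nonzero $u\in\mathrm{Ker}_{\mathbb Z}(M)$ such that no nonzero $v\in\mathrm{Ker}_{\mathbb Z}(M)$ with $v\neq u$ satisfies $v^+\le u^+$ and $v^-\le u^-$. Its set of circuits $\mathcal C(M)$ is the set of nonzero $u\in \mathrm{Ker}_{\mathbb Z}(M)$ with coprime coordinates whose support is minimal among the supports of nonzero elements of $\mathrm{Ker}_{\mathbb Z}(M)$. For a field $K$, the toric ideal is $I_M=(x^{u^+}-x^{u^-}: u\in\mathrm{Ker}_{\mathbb Z}(M))\subset K[x_i : i\in I]$. A minimal Markov basis of $M$ is a subset of $\mathrm{Ker}_{\mathbb Z}(M)$ whose binomials $x^{u^+}-x^{u^-}$ generate $I_M$ while those of no proper subset do. The universal Gröbner basis is the union of the reduced Gröbner bases over all monomial orders. The ideal $I_M$ is strongly robust if, up to the signs of the elements, the Graver basis, the universal Gröbner basis, every reduced Gröbner basis and every minimal Markov basis coincide.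 For a finite hypergraph $\mathcal H=(V,\mathcal E)$ with $\mathcal E=\{E_1,\dots,E_N\}$ let $\alpha_E\in\{0,1\}^V$ be the indicator vector of $E$ and $A_{\mathcal H}=[\alpha_{E_1},\dots,\alpha_{E_N}]$; write $\mathrm{Ker}_{\mathbb Z}(\mathcal H)$, $\mathcal Gr(\mathcal H)$, $\mathcal C(\mathcal H)$, $I_{\mathcal H}$ for the notions of $A_{\mathcal H}$. The edges meeting a set $U\subset V$ form a bouquet with basis $U$ and encoding vector $c\in\mathbb Z^N$ if $\{i: c_i\ne0\}=\{i: E_i\cap U\neq\emptyset\}$, the first nonzero coordinate of $c$ is positive and, over every field, the toric ideal of the multi-hypergraph on $U$ with edges $E_i\cap U\ne\emptyset$ is generated by the binomial $e^{c^+}-e^{c^-}$. A sunflower with core $C$ is a set of edges (petals) that properly contain $C$ and pairwise intersect exactly in $C$. A connected matched-petal partitioned-core sunflower consists of vertex-disjoint sunflowers and a perfect matching of the set of their non-core vertices, such that removing the core vertices leaves a connected hypergraph. Let $A=[a_1,\dots,a_n]\in\mathbb Z^{m\times n}$, $n\ge1$, be a matrix without zero rows or zero columns. Then there are a finite hypergraph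 $\mathcal H=(V,\mathcal E)$ with labelled edges $E_1,\dots,E_N$, distinct vertices $v_1,\dots,v_m\in V$, subsets $U_1,\dots,U_n\subset V$ and vectors $c_1,\dots,c_n\in\mathbb Z^N$ with the following properties. (0) $\mathcal H$ is almost $3$-uniform: every edge has at least one and at most three vertices, and some edge has exactly three. It is built from sunflowers with matched petals: each nonzero entry $a_{ij}$ gives a sunflower $\mathcal S_{ij}$ with $|a_{ij}|$ petals of cardinality $3$ and a one-point core $\{w_{ij}\}$, where $w_{ij}=v_i$ if $a_{ij}>0$ and $w_{ij}\notin\{v_1,\dots,v_m\}$ if $a_{ij}<0$, and whose non-core vertices are not among $v_1,\dots,v_m$; for each $j$ the sunflowers $\mathcal S_{ij}$ together with a perfect matching of their non-core vertices by edges of cardinality $2$ form a connected matched-petal partitioned-core sunflower $\mathcal H_j$; $U_j$ is the set of vertices of $\mathcal H_j$ other than $v_1,\dots,v_m$; and the edges of $\mathcal H$ meeting $U_j$ are the edges of $\mathcal H_j$ and the edges $\{v_i,w_{ij}\}$ with $a_{ij}<0$. Every edge of $\mathcal H$ meets exactly one $U_j$; for every $j$ the edges meeting $U_j$ form a bouquet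 with basis $U_j$ and encoding vector $c_j$; and $\sum_{i=1}^N (c_j)_i\,\alpha_{E_i}\in\mathbb Z^V$ has $v_i$-coordinate $a_{ij}$ for $i=1,\dots,m$ and all other coordinates $0$. (1) The map $u\mapsto B(u)=u_1c_1+\dots+u_nc_n$ restricts to bijections $\mathrm{Ker}_{\mathbb Z}(A)\to\mathrm{Ker}_{\mathbb Z}(\mathcal H)$, $\mathcal Gr(A)\to\mathcal Gr(\mathcal H)$ and $\mathcal C(A)\to\mathcal C(\mathcal H)$. (2) $|u|_1\le|B(u)|_1$ for every $u\in\mathrm{Ker}_{\mathbb Z}(A)$, in particular for every $u\in\mathcal Gr(A)$, where $|\cdot|_1$ is the $1$-norm. (3) Over every field, the toric ideal $I_{\mathcal H}$ is strongly robust. -/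

import Mathlib

open scoped Matrix

namespace ToricHypergraph

/-! ### Toric ideals and their bases -/

/-- The binomial `x^{u⁺} - x^{u⁻}` of an integer vector `u`. -/
noncomputable def toricBinomial (K : Type*) [Field K] {ι : Type*} [Finite ι] (u : ι → ℤ) :
    MvPolynomial ι K :=
  MvPolynomial.monomial (Finsupp.equivFunOnFinite.symm fun i => (u i).toNat) 1 -
    MvPolynomial.monomial (Finsupp.equivFunOnFinite.symm fun i => (-u i).toNat) 1

/-- The lattice `Ker_ℤ(A)` of integer vectors `u` with `A u = 0`. -/
def kerZ {ρ ι : Type*} [Fintype ι] (A : Matrix ρ ι ℤ) : Submodule ℤ (ι → ℤ) :=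
  LinearMap.ker A.mulVecLin

/-- The toric ideal `I_A = (x^{u⁺} - x^{u⁻} : u ∈ Ker_ℤ(A))`. -/
noncomputable def toricIdeal (K : Type*) [Field K] {ρ ι : Type*} [Fintype ι]
    (A : Matrix ρ ι ℤ) : Ideal (MvPolynomial ι K) :=
  Ideal.span (toricBinomial K '' (kerZ A : Set (ι → ℤ)))

/-- The Graver basis: the nonzero kernel vectors `u` that are minimal for the conformal order,
i.e. no nonzero kernel vector `v ≠ u` has `v⁺ ≤ u⁺` and `v⁻ ≤ u⁻`.
It contains `-u` together with `u`. -/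
def graverBasis {ρ ι : Type*} [Fintype ι] (A : Matrix ρ ι ℤ) : Set (ι → ℤ) :=
  {u | u ∈ kerZ A ∧ u ≠ 0 ∧ ∀ v ∈ kerZ A, v ≠ 0 → v⁺ ≤ u⁺ → v⁻ ≤ u⁻ → v = u}

/-- The circuits: the nonzero kernel vectors with coprime coordinates whose support is minimal
among the supports of nonzero kernel vectors. It contains `-u` together with `u`. -/
def circuits {ρ ι : Type*} [Fintype ι] (A : Matrix ρ ι ℤ) : Set (ι → ℤ) :=
  {u | u ∈ kerZ A ∧ u ≠ 0 ∧ Finset.univ.gcd u = 1 ∧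
    ∀ v ∈ kerZ A, v ≠ 0 → Function.support v ⊆ Function.support u →
      Function.support v = Function.support u}

/-- `G` is the reduced Gröbner basis of the ideal `I` for the monomial order `m`: every leading
monomial of `I` is divisible by one of `G`, the elements of `G` are monic, and no monomial of an
element of `G` is divisible by the leading monomial of another one. -/
def IsReducedGroebnerBasis {K : Type*} [Field K] {ι : Type} (m : MonomialOrder.{0, 0} ι)
    (I : Ideal (MvPolynomial ι K)) (G : Set (MvPolynomial ι K)) : Prop :=
  G ⊆ (I : Set (MvPolynomial ι K)) ∧
  (∀ f ∈ I, f ≠ 0 → ∃ g ∈ G, m.degree g ≤ m.degree f) ∧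
  (∀ g ∈ G, m.leadingCoeff g = 1) ∧
  (∀ g ∈ G, ∀ h ∈ G, h ≠ g → ∀ t ∈ g.support, ¬ m.degree h ≤ t)

/-- The universal Gröbner basis: the union of all reduced Gröbner bases. (A monomial order on a
type in `Type` is isomorphic to one whose ordered monoid lies in `Type`.) -/
def universalGroebnerBasis {K : Type*} [Field K] {ι : Type} (I : Ideal (MvPolynomial ι K)) :
    Set (MvPolynomial ι K) :=
  {g | ∃ (m : MonomialOrder.{0, 0} ι) (G : Set (MvPolynomial ι K)),
    IsReducedGroebnerBasis m I G ∧ g ∈ G}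

/-- `M ⊆ Ker_ℤ(A)` is a minimal Markov basis of `A`: its binomials generate the toric ideal and
those of a proper subset never do. -/
def IsMinimalMarkovBasis (K : Type*) [Field K] {ρ ι : Type*} [Fintype ι]
    (A : Matrix ρ ι ℤ) (M : Set (ι → ℤ)) : Prop :=
  M ⊆ (kerZ A : Set (ι → ℤ)) ∧
  Ideal.span (toricBinomial K '' M) = toricIdeal K A ∧
  ∀ M' : Set (ι → ℤ), M' ⊂ M → Ideal.span (toricBinomial K '' M') ≠ toricIdeal K A

/-- The elements of `S` and their negatives. Bases of toric ideals are compared up to sign. -/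
def upToSign {α : Type*} [Neg α] (S : Set α) : Set α :=
  {x | x ∈ S ∨ -x ∈ S}

/-- The toric ideal of `A` is strongly robust: up to sign, the Graver basis, the universal Gröbner
basis, every reduced Gröbner basis and every minimal Markov basis coincide. -/
def IsStronglyRobust (K : Type*) [Field K] {ρ : Type*} {ι : Type} [Fintype ι]
    (A : Matrix ρ ι ℤ) : Prop :=
  upToSign (universalGroebnerBasis (toricIdeal K A)) = toricBinomial K '' graverBasis A ∧
  (∀ (m : MonomialOrder.{0, 0} ι) (G : Set (MvPolynomial ι K)),
    IsReducedGroebnerBasis m (toricIdeal K A) G →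
      upToSign G = toricBinomial K '' graverBasis A) ∧
  (∀ M : Set (ι → ℤ), IsMinimalMarkovBasis K A M → upToSign M = graverBasis A)

/-! ### Hypergraphs and bouquets with bases -/

/-- Almost 3-uniform: every edge has at most three vertices (and at least one), and some edge has
exactly three. -/
def IsAlmostThreeUniform {V : Type*} (H : Hypergraph V) : Prop :=
  (∀ e ∈ H.edgeSet, e.Finite ∧ e.Nonempty ∧ e.ncard ≤ 3) ∧ ∃ e ∈ H.edgeSet, e.ncard = 3

open scoped Classical in
/-- The vertex-edge incidence matrix of a (multi-)hypergraph with edges `E i`. -/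
noncomputable def incidenceMatrix {V ι : Type*} (E : ι → Set V) : Matrix V ι ℤ :=
  Matrix.of fun x i => if x ∈ E i then 1 else 0

/-- The multi-hypergraph on the vertex set `U` whose edges are the nonempty sets `E i ∩ U`, indexed
by the `i` with `E i ∩ U ≠ ∅`. -/
def restrictTo {V ι : Type*} (E : ι → Set V) (U : Set V) :
    {i : ι // (E i ∩ U).Nonempty} → Set U :=
  fun i => {x : U | (x : V) ∈ E i.1}

open scoped Classical in
/-- The edges meeting `U` form a bouquet with basis `U` with encoding vector `c`: the toric ideal of
the restriction to `U` is principal, generated by the binomial of `c`, the support of `c` consists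
of exactly the edges meeting `U`, and the first nonzero coordinate of `c` is positive. -/
def IsBouquetWithBasis (K : Type*) [Field K] {V : Type*} {N : ℕ} (E : Fin N → Set V) (U : Set V)
    (c : Fin N → ℤ) : Prop :=
  (∀ i, c i ≠ 0 ↔ (E i ∩ U).Nonempty) ∧
  toricIdeal K (incidenceMatrix (restrictTo E U)) =
    Ideal.span {toricBinomial K fun i : {i // (E i ∩ U).Nonempty} => c i.1} ∧
  ∃ i, 0 < c i ∧ ∀ k < i, c k = 0

/-- The map `B(u) = u₁ c₁ + ⋯ + uₙ cₙ` given by encoding vectors `c₁, …, cₙ`. -/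
def bouquetMap {n N : ℕ} (c : Fin n → Fin N → ℤ) (u : Fin n → ℤ) : Fin N → ℤ :=
  ∑ j, u j • c j

/-! ### Sunflowers with matched petals -/

/-- The edge set `S` is a sunflower with core `C`. -/
def IsSunflower {V : Type*} (S : Set (Set V)) (C : Set V) : Prop :=
  (∀ e ∈ S, C ⊂ e) ∧ ∀ e ∈ S, ∀ f ∈ S, e ≠ f → e ∩ f = C

/-- `M` is a perfect matching of the vertex set `W`. -/
def IsPerfectMatching {V : Type*} (M : Set (Set V)) (W : Set V) : Prop :=
  M.PairwiseDisjoint id ∧ ⋃₀ M = W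

/-- The primal graph on `W` of the edge set `F`: two distinct vertices of `W` are adjacent when
they lie in a common edge. -/
def primalGraph {V : Type*} (F : Set (Set V)) (W : Set V) : SimpleGraph W :=
  SimpleGraph.fromRel fun x y => ∃ e ∈ F, (x : V) ∈ e ∧ (y : V) ∈ e

/-- Vertex-disjoint sunflowers `S i` with cores `C i` together with the matching `M` form a connected
matched-petal partitioned-core sunflower: `M` is a perfect matching of the non-core vertices, and
the hypergraph becomes a connected one when the cores are removed. -/
def IsConnectedMatchedPetal {V I : Type*} (S : I → Set (Set V)) (C : I → Set V)
    (M : Set (Set V)) : Prop :=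
  (∀ i, IsSunflower (S i) (C i)) ∧
  Pairwise (fun i k => Disjoint (⋃₀ S i) (⋃₀ S k)) ∧
  IsPerfectMatching M (⋃ i, (⋃₀ S i \ C i)) ∧
  (primalGraph ((⋃ i, S i) ∪ M) (⋃ i, (⋃₀ S i \ C i))).Connected

/-- `H` is built from sunflowers with matched petals according to the matrix `A`, with vertices
`v 1, …, v m` for the rows. Every nonzero entry `A i j` gives a 3-uniform sunflower `S i j` with
`|A i j|` petals and a single core vertex `w i j`, which is `v i` if `A i j > 0` and is not one of
the `v k` if `A i j < 0`; the non-core vertices are not among the `v k` either. For each column `j` these sunflowers and a perfect matching `M j` by edges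
of size two form a connected matched-petal partitioned-core sunflower. Its edges, together with the
edges `{v i, w i j}` for `A i j < 0`, are the edges of `H` meeting `U j`, and `U j` consists of its
vertices other than the `v k`. -/
def IsBuiltFromMatchedSunflowers {m n : ℕ} (A : Matrix (Fin m) (Fin n) ℤ) {V : Type*}
    (H : Hypergraph V) (v : Fin m → V) (U : Fin n → Set V) : Prop :=
  ∃ (S : Fin m → Fin n → Set (Set V)) (w : Fin m → Fin n → V) (M : Fin n → Set (Set V)),
    (∀ i j, A i j ≠ 0 → (S i j).ncard = (A i j).natAbs ∧
      ∀ e ∈ S i j, e.ncard = 3 ∧ e ∩ Set.range v ⊆ {w i j}) ∧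
    (∀ i j, 0 < A i j → w i j = v i) ∧
    (∀ i j, A i j < 0 → w i j ∉ Set.range v) ∧
    (∀ j, ∀ e ∈ M j, e.ncard = 2) ∧
    (∀ j, IsConnectedMatchedPetal (fun i : {i // A i j ≠ 0} => S i.1 j)
      (fun i => {w i.1 j}) (M j)) ∧
    (∀ j, U j = (⋃ i : {i // A i j ≠ 0}, ⋃₀ S i.1 j) \ Set.range v) ∧
    (∀ j, {e | e ∈ H.edgeSet ∧ (e ∩ U j).Nonempty} =
      (⋃ i : {i // A i j ≠ 0}, S i.1 j) ∪ M j ∪ {e | ∃ i, A i j < 0 ∧ e = {v i, w i j}})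

end ToricHypergraph

open ToricHypergraph

/-!
Column `j` of `A` becomes a cycle. The entry `A i j` contributes `|A i j|` petals with two non-core
vertices each, and all petals of the column are arranged cyclically (`exists_perm_sameCycle_iff`),
consecutive ones being joined by a matching edge. An integer weighting of the edges that sums to
zero at every non-core vertex is therefore constant on the petals of the column and takes the
opposite value on its matching edges. The edge `{v i, w i j}` of a negative entry has to cancel the
petals at the core vertex `w i j`, which gives it `A i j` times the common value. So the kernel of
the bouquet is generated by one vector with entries `1` on the petals, `-1` on the matching edges
and `A i j` on the remaining edges (`exists_eq_mul_edgeCoeff`). It sums to `A i j` at the vertex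
`v i` (`weightedDegree_blockLift`), so the kernel of the hypergraph consists of the vectors `B(u)`
with `u` in the kernel of `A` (`isBlockLift`).

Everything else only uses that each encoding vector takes both values `1` and `-1` and has no zero
coordinate on its block (`IsBlockLift`). Then `B` preserves and reflects the conformal order,
supports and gcds, hence Graver bases and circuits. Moreover `B(v)⁺ ≤ B(u)⁺` already implies that
`v` is conformal to `u`. For `u` in the Graver basis this means that `x^{B(u)⁺}` and `x^{B(u)⁻}` are
the only monomials in their fibre (`IsBlockLift.hasTwoElementFibres`): every Graver binomial is
indispensable. It thus occurs, up to sign, in each binomial generating set and each reduced Gröbner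
basis. Conversely, the Graver basis generates the toric ideal and is a Gröbner basis for every
monomial order, so no other element can occur (`HasTwoElementFibres.isStronglyRobust`).
-/

namespace ToricHypergraph

/-! ### Conformal decompositions -/

section Conformal

variable {ρ ι : Type*}

lemma posPart_le_iff {u v : ι → ℤ} : v⁺ ≤ u⁺ ↔ ∀ i, (v i).toNat ≤ (u i).toNat := by
  refine forall_congr' fun i => ?_
  simp only [Pi.posPart_apply, posPart_def]
  omega

lemma negPart_le_iff {u v : ι → ℤ} : v⁻ ≤ u⁻ ↔ ∀ i, (-v i).toNat ≤ (-u i).toNat := by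
  refine forall_congr' fun i => ?_
  simp only [Pi.negPart_apply, negPart_def]
  omega

variable [Fintype ι]

/-- The exponent `u⁺` of the first monomial of `toricBinomial K u`; the exponent `u⁻` of the second
one is `posExp (-u)`. -/
noncomputable def posExp (u : ι → ℤ) : ι →₀ ℕ :=
  Finsupp.equivFunOnFinite.symm fun i => (u i).toNat

@[simp] lemma posExp_apply (u : ι → ℤ) (i : ι) : posExp u i = (u i).toNat := rfl

lemma toricBinomial_eq (K : Type*) [Field K] (u : ι → ℤ) :
    toricBinomial K u =
      MvPolynomial.monomial (posExp u) 1 - MvPolynomial.monomial (posExp (-u)) 1 := rfl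

lemma toricBinomial_neg (K : Type*) [Field K] (u : ι → ℤ) :
    toricBinomial K (-u) = -toricBinomial K u := by
  simp [toricBinomial_eq]

lemma eq_of_posExp_eq {u v : ι → ℤ} (h₁ : posExp u = posExp v)
    (h₂ : posExp (-u) = posExp (-v)) : u = v := by
  ext i
  have h₁ := DFunLike.congr_fun h₁ i
  have h₂ := DFunLike.congr_fun h₂ i
  simp only [posExp_apply, Pi.neg_apply] at h₁ h₂
  omega

lemma posExp_ne_posExp_neg {u : ι → ℤ} (hu : u ≠ 0) : posExp u ≠ posExp (-u) := by
  contrapose! hu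
  ext i
  have := DFunLike.congr_fun hu i
  simp only [posExp_apply, Pi.neg_apply, Pi.zero_apply] at this ⊢
  omega

/-- The supports of `u⁺` and `u⁻` are disjoint. -/
lemma eq_zero_of_le_posExp {u : ι → ℤ} {s : ι →₀ ℕ} (h₁ : s ≤ posExp u)
    (h₂ : s ≤ posExp (-u)) : s = 0 := by
  ext i
  have h₁ := h₁ i
  have h₂ := h₂ i
  simp only [posExp_apply, Pi.neg_apply, Finsupp.coe_zero, Pi.zero_apply] at h₁ h₂ ⊢
  omega

lemma neg_mem_graverBasis {A : Matrix ρ ι ℤ} {u : ι → ℤ} (hu : u ∈ graverBasis A) :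
    -u ∈ graverBasis A := by
  obtain ⟨h₁, h₂, h₃⟩ := hu
  refine ⟨neg_mem h₁, neg_ne_zero.2 h₂, fun v hv hv0 hp hn => ?_⟩
  rw [eq_comm, neg_eq_iff_eq_neg, eq_comm]
  refine h₃ (-v) (neg_mem hv) (neg_ne_zero.2 hv0) ?_ ?_
  · rwa [posPart_neg, ← neg_neg u, posPart_neg]
  · rwa [negPart_neg, ← posPart_neg]

/-- Every kernel vector is a conformal sum of elements of the Graver basis, stated as an induction
principle. -/
lemma conformal_induction {A : Matrix ρ ι ℤ} {P : (ι → ℤ) → Prop} (h0 : P 0)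
    (hG : ∀ u ∈ graverBasis A, P u)
    (hadd : ∀ v w, posExp (v + w) = posExp v + posExp w →
      posExp (-(v + w)) = posExp (-v) + posExp (-w) → P v → P w → P (v + w)) :
    ∀ u ∈ kerZ A, P u := by
  intro u
  induction hN : ∑ i, (u i).natAbs using Nat.strong_induction_on generalizing u with
  | _ N ih =>
  intro hu
  by_cases hu0 : u = 0
  · exact hu0 ▸ h0
  by_cases hug : u ∈ graverBasis A
  · exact hG u hug
  obtain ⟨v, hv, hv0, hp, hn, hvu⟩ :
      ∃ v ∈ kerZ A, v ≠ 0 ∧ v⁺ ≤ u⁺ ∧ v⁻ ≤ u⁻ ∧ v ≠ u := by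
    by_contra! hcon
    exact hug ⟨hu, hu0, hcon⟩
  rw [posPart_le_iff] at hp
  rw [negPart_le_iff] at hn
  have hsum : ∑ i, (v i).natAbs + ∑ i, ((u - v) i).natAbs = N := by
    rw [← hN, ← Finset.sum_add_distrib]
    refine Finset.sum_congr rfl fun i _ => ?_
    have := hp i
    have := hn i
    simp only [Pi.sub_apply]
    omega
  have hpos : ∀ w : ι → ℤ, w ≠ 0 → 0 < ∑ i, (w i).natAbs := by
    intro w hw
    obtain ⟨i, hi⟩ := Function.ne_iff.1 hw
    exact Finset.sum_pos' (fun _ _ => Nat.zero_le _) ⟨i, Finset.mem_univ _, Int.natAbs_pos.2 hi⟩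
  have h1 := hpos v hv0
  have h2 := hpos (u - v) (sub_ne_zero.2 hvu.symm)
  have key := hadd v (u - v) ?_ ?_ (ih _ (by omega) v rfl hv)
    (ih _ (by omega) (u - v) rfl (sub_mem hu hv))
  · rwa [add_sub_cancel] at key
  · ext i
    have := hp i
    have := hn i
    simp only [posExp_apply, Pi.add_apply, Pi.sub_apply, Finsupp.add_apply]
    omega
  · ext i
    have := hp i
    have := hn i
    simp only [posExp_apply, Pi.add_apply, Pi.sub_apply, Finsupp.add_apply, Pi.neg_apply]
    omega

lemma toricBinomial_mem_span_graverBasis (K : Type*) [Field K] {A : Matrix ρ ι ℤ} {u : ι → ℤ}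
    (hu : u ∈ kerZ A) : toricBinomial K u ∈ Ideal.span (toricBinomial K '' graverBasis A) := by
  refine conformal_induction (P := fun u => toricBinomial K u ∈
    Ideal.span (toricBinomial K '' graverBasis A)) ?_ ?_ ?_ u hu
  · simp [toricBinomial_eq]
  · exact fun u hu => Ideal.subset_span ⟨u, hu, rfl⟩
  · intro v w h₁ h₂ hv hw
    have : toricBinomial K (v + w) =
        MvPolynomial.monomial (posExp w) 1 * toricBinomial K v +
          MvPolynomial.monomial (posExp (-v)) 1 * toricBinomial K w := by
      simp only [toricBinomial_eq, h₁, h₂, mul_sub, MvPolynomial.monomial_mul, mul_one]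
      rw [add_comm (posExp w), add_comm (posExp w)]
      ring
    rw [this]
    exact add_mem (Ideal.mul_mem_left _ _ hv) (Ideal.mul_mem_left _ _ hw)

lemma span_graverBasis (K : Type*) [Field K] (A : Matrix ρ ι ℤ) :
    Ideal.span (toricBinomial K '' graverBasis A) = toricIdeal K A := by
  refine le_antisymm (Ideal.span_mono (Set.image_mono fun u hu => hu.1)) (Ideal.span_le.2 ?_)
  rintro _ ⟨u, hu, rfl⟩
  exact toricBinomial_mem_span_graverBasis K hu

/-- If `x^{u⁺}` is the leading monomial of the binomial of a kernel vector `u`, it is divisible by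
the leading monomial of the binomial of an element of the Graver basis. -/
lemma exists_graverBasis_posExp_le {A : Matrix ρ ι ℤ} (m : MonomialOrder ι) {u : ι → ℤ}
    (hu : u ∈ kerZ A) (hlt : m.toSyn (posExp (-u)) < m.toSyn (posExp u)) :
    ∃ v ∈ graverBasis A, posExp v ≤ posExp u ∧ m.toSyn (posExp (-v)) < m.toSyn (posExp v) := by
  refine conformal_induction (A := A) (P := fun u => m.toSyn (posExp (-u)) < m.toSyn (posExp u) →
    ∃ v ∈ graverBasis A, posExp v ≤ posExp u ∧ m.toSyn (posExp (-v)) < m.toSyn (posExp v))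
    ?_ ?_ ?_ u hu hlt
  · simp
  · exact fun u hu hlt => ⟨u, hu, le_rfl, hlt⟩
  · intro v w h₁ h₂ hv hw hlt
    rw [h₁, h₂, map_add, map_add] at hlt
    rcases lt_or_ge (m.toSyn (posExp (-v))) (m.toSyn (posExp v)) with h | h
    · obtain ⟨x, hx, hle, hx'⟩ := hv h
      exact ⟨x, hx, hle.trans (h₁ ▸ le_self_add), hx'⟩
    · obtain ⟨x, hx, hle, hx'⟩ := hw (by
        by_contra! hcon
        exact absurd (add_le_add h hcon) (not_le.2 hlt))
      exact ⟨x, hx, hle.trans (h₁ ▸ le_add_self), hx'⟩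

end Conformal

/-! ### Fibres of the toric ideal -/

section Fibres

variable {ρ ι : Type*} {K : Type*} [Field K]

/-- A linear functional that vanishes on all monomial multiples of the generators of an ideal
vanishes on the ideal. -/
lemma linearMap_eq_zero_of_mem_span {X : Set (MvPolynomial ι K)} (φ : MvPolynomial ι K →ₗ[K] K)
    (h : ∀ g ∈ X, ∀ s, φ (MvPolynomial.monomial s 1 * g) = 0) {f : MvPolynomial ι K}
    (hf : f ∈ Ideal.span X) : φ f = 0 := by
  suffices H : ∀ p, φ (p * f) = 0 by simpa using H 1
  induction hf using Submodule.span_induction with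
  | mem g hg =>
    intro p
    induction p using MvPolynomial.induction_on' with
    | monomial s a =>
      have : (MvPolynomial.monomial s a : MvPolynomial ι K) * g =
          a • (MvPolynomial.monomial s 1 * g) := by
        rw [← smul_mul_assoc, MvPolynomial.smul_monomial, smul_eq_mul, mul_one]
      rw [this, map_smul, h g hg, smul_zero]
    | add p q hp hq => rw [add_mul, map_add, hp, hq, add_zero]
  | zero => simp
  | add f g _ _ hf hg => intro p; rw [mul_add, map_add, hf, hg, add_zero]
  | smul q f _ hf => intro p; rw [smul_eq_mul, ← mul_assoc]; exact hf _

/-- The coefficients of an element of the toric ideal sum to zero over each fibre. In particular,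
with a monomial it contains a second one from the same fibre. -/
lemma exists_mem_support_of_mem_toricIdeal [Fintype ι] {A : Matrix ρ ι ℤ} {f : MvPolynomial ι K}
    (hf : f ∈ toricIdeal K A) {t : ι →₀ ℕ} (ht : t ∈ f.support) :
    ∃ s ∈ f.support, s ≠ t ∧ (fun i => (t i : ℤ) - s i) ∈ kerZ A := by
  classical
  by_contra! hcon
  let φ : MvPolynomial ι K →ₗ[K] K := (MvPolynomial.basisMonomials ι K).constr K
    fun s => if (fun i => (t i : ℤ) - s i) ∈ kerZ A then 1 else 0
  have hφ (s : ι →₀ ℕ) : φ (MvPolynomial.monomial s 1) =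
      if (fun i => (t i : ℤ) - s i) ∈ kerZ A then 1 else 0 := by
    have := (MvPolynomial.basisMonomials ι K).constr_basis K
      (fun s => if (fun i => (t i : ℤ) - s i) ∈ kerZ A then (1 : K) else 0) s
    rwa [MvPolynomial.coe_basisMonomials] at this
  have h0 : φ f = 0 := by
    refine linearMap_eq_zero_of_mem_span φ ?_ hf
    rintro _ ⟨u, hu, rfl⟩ s
    rw [toricBinomial_eq, mul_sub, MvPolynomial.monomial_mul, MvPolynomial.monomial_mul, mul_one,
      map_sub, hφ, hφ, sub_eq_zero]
    congr 1
    have : (fun i => (t i : ℤ) - ((s + posExp (-u)) i : ℕ)) =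
        (fun i => (t i : ℤ) - ((s + posExp u) i : ℕ)) + u := by
      ext i
      simp only [Finsupp.add_apply, posExp_apply, Pi.neg_apply, Pi.add_apply]
      omega
    rw [this, eq_iff_iff, Submodule.add_mem_iff_left _ hu]
  have h1 : φ f = f.coeff t := by
    conv_lhs => rw [f.as_sum, map_sum]
    rw [Finset.sum_eq_single t]
    · rw [← mul_one (f.coeff t), ← smul_eq_mul, ← MvPolynomial.smul_monomial, map_smul, hφ]
      have h : (fun i => (t i : ℤ) - t i) ∈ kerZ A := by
        convert zero_mem (kerZ A) using 1
        ext i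
        simp
      rw [if_pos h, smul_eq_mul, mul_one]
    · intro s hs hst
      rw [← mul_one (f.coeff s), ← smul_eq_mul, ← MvPolynomial.smul_monomial, map_smul, hφ,
        if_neg (hcon s hs hst), smul_zero]
    · exact fun h => absurd ht h
  exact MvPolynomial.mem_support_iff.1 ht (h1 ▸ h0)

end Fibres

/-! ### Strong robustness from two-element fibres -/

section Robust

/-- The fibre of `x^{u⁺}` consists of `x^{u⁺}` and `x^{u⁻}` for each `u` in the Graver basis; in
other words, all binomials of the Graver basis are indispensable. -/
def HasTwoElementFibres {ρ ι : Type*} [Fintype ι] (A : Matrix ρ ι ℤ) : Prop :=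
  ∀ u ∈ graverBasis A, ∀ z : ι →₀ ℕ, (fun i => ((posExp u i : ℕ) : ℤ) - z i) ∈ kerZ A →
    z = posExp u ∨ z = posExp (-u)

variable {ρ : Type*} {ι : Type} [Fintype ι] {A : Matrix ρ ι ℤ}

lemma HasTwoElementFibres.add_posExp_neg (hA : HasTwoElementFibres A) {u v : ι → ℤ}
    (hu : u ∈ graverBasis A) (hv : v ∈ kerZ A) {s : ι →₀ ℕ} (hs : s + posExp v = posExp u) :
    s + posExp (-v) = posExp u ∨ s + posExp (-v) = posExp (-u) := by
  refine hA u hu _ ?_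
  convert hv using 1
  ext i
  rw [← hs]
  simp only [Finsupp.add_apply, posExp_apply, Pi.neg_apply]
  omega

/-- If `x^{v⁺}` divides `x^{u⁺}` with `u` in the Graver basis then `v = u`. -/
lemma HasTwoElementFibres.eq_of_posExp_le (hA : HasTwoElementFibres A) {u v : ι → ℤ}
    (hu : u ∈ graverBasis A) (hv : v ∈ kerZ A) (hv0 : v ≠ 0) (h : posExp v ≤ posExp u) :
    v = u := by
  obtain ⟨s, hs⟩ := exists_add_of_le h
  rw [add_comm] at hs
  rcases hA.add_posExp_neg hu hv hs.symm with h' | h'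
  · exact absurd (add_left_cancel (hs.symm.trans h'.symm)) (posExp_ne_posExp_neg hv0)
  · have hs0 : s = 0 := eq_zero_of_le_posExp (hs ▸ le_self_add) (h' ▸ le_self_add)
    subst hs0
    rw [zero_add] at hs h'
    exact eq_of_posExp_eq hs.symm h'

variable {K : Type*} [Field K]

lemma degree_toricBinomial (m : MonomialOrder ι) {u : ι → ℤ}
    (h : m.toSyn (posExp (-u)) < m.toSyn (posExp u)) :
    m.degree (toricBinomial K u) = posExp u := by
  classical
  rw [toricBinomial_eq, m.degree_sub_of_lt, m.degree_monomial, if_neg one_ne_zero]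
  simpa [m.degree_monomial] using h

lemma mem_support_toricBinomial {u : ι → ℤ} (hu : u ≠ 0) {t : ι →₀ ℕ} :
    t ∈ (toricBinomial K u).support ↔ t = posExp u ∨ t = posExp (-u) := by
  classical
  have := posExp_ne_posExp_neg hu
  rw [MvPolynomial.mem_support_iff, toricBinomial_eq, MvPolynomial.coeff_sub,
    MvPolynomial.coeff_monomial, MvPolynomial.coeff_monomial]
  by_cases h₁ : posExp u = t
  · subst h₁
    simp [this.symm]
  · by_cases h₂ : posExp (-u) = t
    · subst h₂
      simp [h₁]
    · simp [h₁, h₂, Ne.symm h₁, Ne.symm h₂]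

lemma coeff_toricBinomial {u : ι → ℤ} (hu : u ≠ 0) :
    (toricBinomial K u).coeff (posExp u) = 1 := by
  classical
  rw [toricBinomial_eq, MvPolynomial.coeff_sub, MvPolynomial.coeff_monomial, if_pos rfl,
    MvPolynomial.coeff_monomial, if_neg (posExp_ne_posExp_neg hu).symm, sub_zero]

lemma toricBinomial_mem_toricIdeal {u : ι → ℤ} (hu : u ∈ kerZ A) :
    toricBinomial K u ∈ toricIdeal K A :=
  Ideal.subset_span ⟨u, hu, rfl⟩

/-- The Graver basis is a Gröbner basis for every monomial order. -/
lemma exists_graverBasis_posExp_le_degree (m : MonomialOrder ι) {f : MvPolynomial ι K}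
    (hf : f ∈ toricIdeal K A) (hf0 : f ≠ 0) :
    ∃ v ∈ graverBasis A, posExp v ≤ m.degree f ∧
      m.toSyn (posExp (-v)) < m.toSyn (posExp v) := by
  obtain ⟨s, hs, hst, hker⟩ := exists_mem_support_of_mem_toricIdeal hf (m.degree_mem_support hf0)
  set t := m.degree f
  set a : ι → ℤ := fun i => (t i : ℤ) - s i with ha
  have hlt : m.toSyn s < m.toSyn t :=
    lt_of_le_of_ne (m.le_degree hs) (fun h => hst (m.toSyn.injective h))
  -- `t = g + a⁺` and `s = g + a⁻`, where `x^g` is the greatest common divisor of `x^t` and `x^s`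
  have ht : t = t ⊓ s + posExp a := by
    ext i
    simp only [Finsupp.add_apply, Finsupp.inf_apply, posExp_apply, ha]
    omega
  have hs' : s = t ⊓ s + posExp (-a) := by
    ext i
    simp only [Finsupp.add_apply, Finsupp.inf_apply, posExp_apply, ha, Pi.neg_apply]
    omega
  have hlt' : m.toSyn (posExp (-a)) < m.toSyn (posExp a) := by
    refine lt_of_add_lt_add_left (a := m.toSyn (t ⊓ s)) ?_
    rwa [← map_add, ← map_add, ← ht, ← hs']
  obtain ⟨v, hv, hle, hv'⟩ := exists_graverBasis_posExp_le m hker hlt'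
  exact ⟨v, hv, hle.trans (by rw [ht]; exact le_add_self), hv'⟩

lemma lt_or_lt_neg (m : MonomialOrder ι) {u : ι → ℤ} (hu : u ≠ 0) :
    m.toSyn (posExp (-u)) < m.toSyn (posExp u) ∨
      m.toSyn (posExp (- -u)) < m.toSyn (posExp (-u)) := by
  rw [neg_neg]
  exact lt_or_gt_of_ne fun h => posExp_ne_posExp_neg hu (m.toSyn.injective h).symm

/-- Every binomial of the Graver basis, with the sign that makes it monic, lies in every reduced
Gröbner basis. -/
lemma HasTwoElementFibres.mem_of_isReducedGroebnerBasis (hA : HasTwoElementFibres A)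
    {m : MonomialOrder.{0, 0} ι} {G : Set (MvPolynomial ι K)}
    (hG : IsReducedGroebnerBasis m (toricIdeal K A) G) {u : ι → ℤ} (hu : u ∈ graverBasis A)
    (hlt : m.toSyn (posExp (-u)) < m.toSyn (posExp u)) : toricBinomial K u ∈ G := by
  classical
  obtain ⟨hGI, hlead, hmonic, hred⟩ := hG
  set f := toricBinomial K u
  have hfI : f ∈ toricIdeal K A := toricBinomial_mem_toricIdeal hu.1
  have hf0 : f ≠ 0 := by
    intro h
    have := coeff_toricBinomial (K := K) hu.2.1
    simp [show toricBinomial K u = 0 from h] at this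
  obtain ⟨g, hg, hdeg⟩ := hlead f hfI hf0
  rw [degree_toricBinomial m hlt] at hdeg
  have hg0 : g ≠ 0 := by
    rintro rfl
    simpa using hmonic 0 hg
  obtain ⟨s, hs⟩ := exists_add_of_le hdeg
  rw [add_comm] at hs
  -- the fibre of `x^{u⁺}` forces `x^{u⁻}` to occur in `x^s g`, so `s = 0`
  obtain ⟨z, hz, hzu, hker⟩ := exists_mem_support_of_mem_toricIdeal
    (f := MvPolynomial.monomial s 1 * g) (t := posExp u) (A := A)
    (Ideal.mul_mem_left _ _ (hGI hg)) (by
      rw [hs, MvPolynomial.mem_support_iff, MvPolynomial.coeff_monomial_mul, one_mul]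
      exact m.leadingCoeff_ne_zero_iff.2 hg0)
  obtain rfl := (hA u hu z hker).resolve_left hzu
  rw [MvPolynomial.mem_support_iff, MvPolynomial.coeff_monomial_mul'] at hz
  have hs0 : s = 0 := by
    refine eq_zero_of_le_posExp (hs ▸ le_self_add) ?_
    by_contra h
    rw [if_neg h] at hz
    exact hz rfl
  subst hs0
  rw [zero_add] at hs
  rw [if_pos (zero_le), one_mul, tsub_zero] at hz
  have hfg : f.support ⊆ g.support := by
    intro t ht
    rcases (mem_support_toricBinomial hu.2.1).1 ht with rfl | rfl
    · exact hs ▸ m.degree_mem_support hg0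
    · exact MvPolynomial.mem_support_iff.2 hz
  by_contra hf
  have hne : g - f ≠ 0 := fun h => hf (sub_eq_zero.1 h ▸ hg)
  obtain ⟨h, hh, hle⟩ := hlead (g - f) (sub_mem (hGI hg) hfI) hne
  have ht := m.degree_mem_support hne
  have htg : m.degree (g - f) ∈ g.support := by
    by_contra hgt
    have hft : m.degree (g - f) ∉ f.support := fun h => hgt (hfg h)
    rw [MvPolynomial.notMem_support_iff] at hgt hft
    rw [MvPolynomial.mem_support_iff, MvPolynomial.coeff_sub, hgt, hft, sub_zero] at ht
    exact ht rfl
  by_cases hhg : h = g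
  · subst hhg
    have heq : m.degree (h - f) = m.degree h :=
      m.toSyn.injective (le_antisymm (m.le_degree htg) (m.toSyn_monotone hle))
    rw [heq, MvPolynomial.mem_support_iff, MvPolynomial.coeff_sub] at ht
    have h1 : h.coeff (m.degree h) = 1 := hmonic h hg
    have h2 : f.coeff (m.degree h) = 1 := hs ▸ coeff_toricBinomial hu.2.1
    exact ht (by rw [h1, h2, sub_self])
  · exact hred g hg h hh hhg _ htg hle

lemma HasTwoElementFibres.upToSign_eq (hA : HasTwoElementFibres A) {m : MonomialOrder.{0, 0} ι}
    {G : Set (MvPolynomial ι K)} (hG : IsReducedGroebnerBasis m (toricIdeal K A) G) :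
    upToSign G = toricBinomial K '' graverBasis A := by
  have hsub : ∀ g ∈ G, g ∈ toricBinomial K '' graverBasis A := by
    intro g hg
    have hg0 : g ≠ 0 := by
      rintro rfl
      simpa using hG.2.2.1 0 hg
    obtain ⟨v, hv, hle, hlt⟩ := exists_graverBasis_posExp_le_degree m (hG.1 hg) hg0
    refine ⟨v, hv, ?_⟩
    by_contra hne
    refine hG.2.2.2 g hg _ (hA.mem_of_isReducedGroebnerBasis hG hv hlt) hne _
      (m.degree_mem_support hg0) ?_
    rwa [degree_toricBinomial m hlt]
  ext g
  constructor
  · rintro (hg | hg)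
    · exact hsub g hg
    · obtain ⟨v, hv, hvg⟩ := hsub _ hg
      exact ⟨-v, neg_mem_graverBasis hv, by rw [toricBinomial_neg, hvg, neg_neg]⟩
  · rintro ⟨u, hu, rfl⟩
    rcases lt_or_lt_neg m hu.2.1 with h | h
    · exact Or.inl (hA.mem_of_isReducedGroebnerBasis hG hu h)
    · refine Or.inr ?_
      rw [← toricBinomial_neg]
      exact hA.mem_of_isReducedGroebnerBasis hG (neg_mem_graverBasis hu) h

/-- The binomials of the Graver basis, with the signs that make them monic, form a reduced Gröbner
basis. -/
lemma HasTwoElementFibres.isReducedGroebnerBasis (hA : HasTwoElementFibres A)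
    (m : MonomialOrder.{0, 0} ι) :
    IsReducedGroebnerBasis m (toricIdeal K A) (toricBinomial K ''
      {u | u ∈ graverBasis A ∧ m.toSyn (posExp (-u)) < m.toSyn (posExp u)}) := by
  refine ⟨?_, ?_, ?_, ?_⟩
  · rintro _ ⟨u, ⟨hu, -⟩, rfl⟩
    exact toricBinomial_mem_toricIdeal hu.1
  · intro f hf hf0
    obtain ⟨v, hv, hle, hlt⟩ := exists_graverBasis_posExp_le_degree m hf hf0
    exact ⟨_, ⟨v, ⟨hv, hlt⟩, rfl⟩, by rwa [degree_toricBinomial m hlt]⟩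
  · rintro _ ⟨u, ⟨hu, hlt⟩, rfl⟩
    rw [MonomialOrder.leadingCoeff, degree_toricBinomial m hlt, coeff_toricBinomial hu.2.1]
  · rintro _ ⟨u, ⟨hu, hult⟩, rfl⟩ _ ⟨v, ⟨hv, hvlt⟩, rfl⟩ hne t ht hle
    rw [degree_toricBinomial m hvlt] at hle
    rcases (mem_support_toricBinomial hu.2.1).1 ht with rfl | rfl
    · exact hne (by rw [hA.eq_of_posExp_le hu hv.1 hv.2.1 hle])
    · obtain rfl := hA.eq_of_posExp_le (neg_mem_graverBasis hu) hv.1 hv.2.1 hle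
      rw [neg_neg] at hvlt
      exact lt_asymm hult hvlt

/-- Every generating set of binomials contains the Graver basis up to sign. -/
lemma HasTwoElementFibres.mem_or_neg_mem (hA : HasTwoElementFibres A) {M : Set (ι → ℤ)}
    (hM : M ⊆ kerZ A) (hspan : Ideal.span (toricBinomial K '' M) = toricIdeal K A) {u : ι → ℤ}
    (hu : u ∈ graverBasis A) : u ∈ M ∨ -u ∈ M := by
  classical
  by_contra! hcon
  have key : MvPolynomial.lcoeff K (posExp u) (toricBinomial K u) = 0 := by
    refine linearMap_eq_zero_of_mem_span _ ?_ (hspan ▸ toricBinomial_mem_toricIdeal hu.1)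
    rintro _ ⟨a, ha, rfl⟩ s
    by_cases ha0 : a = 0
    · simp [ha0, toricBinomial_eq]
    have h₁ : s + posExp a ≠ posExp u := fun h =>
      hcon.1 (hA.eq_of_posExp_le hu (hM ha) ha0 (h ▸ le_add_self) ▸ ha)
    have h₂ : s + posExp (-a) ≠ posExp u := fun h => by
      refine hcon.2 ?_
      rw [← hA.eq_of_posExp_le hu (neg_mem (hM ha)) (neg_ne_zero.2 ha0) (h ▸ le_add_self), neg_neg]
      exact ha
    rw [toricBinomial_eq, mul_sub, MvPolynomial.monomial_mul, MvPolynomial.monomial_mul,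
      MvPolynomial.lcoeff_apply, MvPolynomial.coeff_sub, MvPolynomial.coeff_monomial,
      MvPolynomial.coeff_monomial, if_neg h₁, if_neg h₂, sub_zero]
  rw [MvPolynomial.lcoeff_apply, coeff_toricBinomial hu.2.1] at key
  exact one_ne_zero key

lemma HasTwoElementFibres.upToSign_eq_of_isMinimalMarkovBasis (hA : HasTwoElementFibres A)
    {M : Set (ι → ℤ)} (hM : IsMinimalMarkovBasis K A M) : upToSign M = graverBasis A := by
  obtain ⟨hker, hspan, hmin⟩ := hM
  have hsub : M ⊆ graverBasis A := by
    by_contra hnot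
    refine hmin (M ∩ graverBasis A) ?_ ?_
    · exact Set.inter_ssubset_left_iff.2 hnot
    · refine le_antisymm (hspan ▸ Ideal.span_mono (Set.image_mono Set.inter_subset_left)) ?_
      rw [← span_graverBasis, Ideal.span_le]
      rintro _ ⟨u, hu, rfl⟩
      rcases hA.mem_or_neg_mem hker hspan hu with h | h
      · exact Ideal.subset_span ⟨u, ⟨h, hu⟩, rfl⟩
      · rw [← neg_neg u, toricBinomial_neg]
        exact neg_mem (Ideal.subset_span ⟨-u, ⟨h, neg_mem_graverBasis hu⟩, rfl⟩)
  ext u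
  constructor
  · rintro (h | h)
    · exact hsub h
    · exact neg_neg u ▸ neg_mem_graverBasis (hsub h)
  · exact hA.mem_or_neg_mem hker hspan

theorem HasTwoElementFibres.isStronglyRobust (hA : HasTwoElementFibres A) (K : Type*) [Field K] :
    IsStronglyRobust K A := by
  refine ⟨?_, fun m G hG => hA.upToSign_eq hG,
    fun M hM => hA.upToSign_eq_of_isMinimalMarkovBasis hM⟩
  ext g
  constructor
  · rintro (⟨m, G, hG, hg⟩ | ⟨m, G, hG, hg⟩)
    · exact hA.upToSign_eq hG ▸ Or.inl hg
    · exact hA.upToSign_eq hG ▸ Or.inr hg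
  · -- some monomial order exists: the lexicographic one for any linear order of the variables
    intro hg
    let m : MonomialOrder.{0, 0} ι :=
      letI : LinearOrder ι := LinearOrder.lift' (Fintype.equivFin ι) (Fintype.equivFin ι).injective
      MonomialOrder.lex
    have hG := hA.isReducedGroebnerBasis (K := K) m
    rw [← hA.upToSign_eq hG] at hg
    exact hg.imp (fun h => ⟨m, _, hG, h⟩) (fun h => ⟨m, _, hG, h⟩)

end Robust

/-! ### Kernels that are block lifts -/

section BlockLift

variable {ρ ρ' ι κ : Type*}

/-- The vector that is `w j • γ` on the block `col ⁻¹' {j}` of coordinates, for each `j`. -/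
def blockLift (col : ι → κ) (γ : ι → ℤ) (w : κ → ℤ) : ι → ℤ :=
  fun i => w (col i) * γ i

/-- The kernel of `M` is the image of the kernel of `A` under `blockLift col γ`, the vector `γ` has
no zero coordinate, and it takes both values `1` and `-1` on each block. -/
structure IsBlockLift [Fintype ι] [Fintype κ] (A : Matrix ρ κ ℤ) (M : Matrix ρ' ι ℤ)
    (col : ι → κ) (γ : ι → ℤ) : Prop where
  mem_kerZ_iff : ∀ x, x ∈ kerZ M ↔ ∃ w ∈ kerZ A, blockLift col γ w = x
  ne_zero : ∀ i, γ i ≠ 0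
  exists_eq_one : ∀ j, ∃ i, col i = j ∧ γ i = 1
  exists_eq_neg_one : ∀ j, ∃ i, col i = j ∧ γ i = -1

namespace IsBlockLift

variable [Fintype ι] [Fintype κ] {A : Matrix ρ κ ℤ} {M : Matrix ρ' ι ℤ} {col : ι → κ} {γ : ι → ℤ}

lemma injective (h : IsBlockLift A M col γ) : Function.Injective (blockLift col γ) := by
  intro v w hvw
  ext j
  obtain ⟨i, rfl, hi⟩ := h.exists_eq_one j
  simpa [blockLift, hi] using congr_fun hvw i

lemma blockLift_mem_iff (h : IsBlockLift A M col γ) {w : κ → ℤ} :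
    blockLift col γ w ∈ kerZ M ↔ w ∈ kerZ A := by
  rw [h.mem_kerZ_iff]
  exact ⟨fun ⟨v, hv, hvw⟩ => h.injective hvw ▸ hv, fun hw => ⟨w, hw, rfl⟩⟩

lemma blockLift_eq_zero_iff (h : IsBlockLift A M col γ) {w : κ → ℤ} :
    blockLift col γ w = 0 ↔ w = 0 := by
  have h0 : blockLift col γ 0 = 0 := by ext i; simp [blockLift]
  rw [← h0, h.injective.eq_iff]

lemma bijOn_kerZ (h : IsBlockLift A M col γ) :
    Set.BijOn (blockLift col γ) (kerZ A) (kerZ M) :=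
  ⟨fun _ hw => h.blockLift_mem_iff.2 hw, h.injective.injOn, fun x hx => (h.mem_kerZ_iff x).1 hx⟩

/-- As `γ` takes both values `1` and `-1` on each block, the positive part of a lift controls both
signs of the original vector. -/
lemma toNat_le_of_toNat_blockLift_le (h : IsBlockLift A M col γ) {v w : κ → ℤ}
    (hvw : ∀ i, (blockLift col γ v i).toNat ≤ (blockLift col γ w i).toNat) (j : κ) :
    (v j).toNat ≤ (w j).toNat ∧ (-v j).toNat ≤ (-w j).toNat := by
  obtain ⟨i, rfl, hi⟩ := h.exists_eq_one j
  obtain ⟨k, hk, hk'⟩ := h.exists_eq_neg_one (col i)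
  have h₁ := hvw i
  have h₂ := hvw k
  simp only [blockLift, hi, hk, hk', mul_one, mul_neg] at h₁ h₂
  exact ⟨h₁, h₂⟩

lemma toNat_mul_le {a b c : ℤ} (h₁ : a.toNat ≤ b.toNat) (h₂ : (-a).toNat ≤ (-b).toNat) :
    (a * c).toNat ≤ (b * c).toNat := by
  have : 0 ≤ a ∧ a ≤ b ∨ b ≤ a ∧ a ≤ 0 := by omega
  rcases this with ⟨h, h'⟩ | ⟨h, h'⟩ <;> rcases le_total 0 c with hc | hc
  · exact Int.toNat_le_toNat (by nlinarith)
  · rw [Int.toNat_of_nonpos (mul_nonpos_of_nonneg_of_nonpos h hc)]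
    exact Nat.zero_le _
  · rw [Int.toNat_of_nonpos (mul_nonpos_of_nonpos_of_nonneg h' hc)]
    exact Nat.zero_le _
  · exact Int.toNat_le_toNat (by nlinarith)

lemma conformal_iff (h : IsBlockLift A M col γ) {v w : κ → ℤ} :
    (blockLift col γ v)⁺ ≤ (blockLift col γ w)⁺ ∧ (blockLift col γ v)⁻ ≤ (blockLift col γ w)⁻ ↔
      v⁺ ≤ w⁺ ∧ v⁻ ≤ w⁻ := by
  simp only [posPart_le_iff, negPart_le_iff]
  constructor
  · rintro ⟨h₁, -⟩
    exact ⟨fun j => (h.toNat_le_of_toNat_blockLift_le h₁ j).1,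
      fun j => (h.toNat_le_of_toNat_blockLift_le h₁ j).2⟩
  · rintro ⟨h₁, h₂⟩
    refine ⟨fun i => toNat_mul_le (h₁ _) (h₂ _), fun i => ?_⟩
    simp only [blockLift, ← mul_neg]
    exact toNat_mul_le (h₁ _) (h₂ _)

lemma blockLift_mem_graverBasis_iff (h : IsBlockLift A M col γ) {w : κ → ℤ} :
    blockLift col γ w ∈ graverBasis M ↔ w ∈ graverBasis A := by
  constructor
  · rintro ⟨h₁, h₂, h₃⟩
    refine ⟨h.blockLift_mem_iff.1 h₁, fun h0 => h₂ (h.blockLift_eq_zero_iff.2 h0), ?_⟩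
    intro v hv hv0 hp hn
    have := h.conformal_iff.2 ⟨hp, hn⟩
    exact h.injective (h₃ _ (h.blockLift_mem_iff.2 hv)
      (fun h0 => hv0 (h.blockLift_eq_zero_iff.1 h0)) this.1 this.2)
  · rintro ⟨h₁, h₂, h₃⟩
    refine ⟨h.blockLift_mem_iff.2 h₁, fun h0 => h₂ (h.blockLift_eq_zero_iff.1 h0), ?_⟩
    intro x hx hx0 hp hn
    obtain ⟨v, hv, rfl⟩ := (h.mem_kerZ_iff x).1 hx
    have := h.conformal_iff.1 ⟨hp, hn⟩
    rw [h₃ v hv (fun h0 => hx0 (h.blockLift_eq_zero_iff.2 h0)) this.1 this.2]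

lemma bijOn_graverBasis (h : IsBlockLift A M col γ) :
    Set.BijOn (blockLift col γ) (graverBasis A) (graverBasis M) := by
  refine ⟨fun w hw => h.blockLift_mem_graverBasis_iff.2 hw, h.injective.injOn, fun x hx => ?_⟩
  obtain ⟨w, -, rfl⟩ := (h.mem_kerZ_iff x).1 hx.1
  exact ⟨w, h.blockLift_mem_graverBasis_iff.1 hx, rfl⟩

lemma support_subset_iff (h : IsBlockLift A M col γ) {v w : κ → ℤ} :
    Function.support (blockLift col γ v) ⊆ Function.support (blockLift col γ w) ↔
      Function.support v ⊆ Function.support w := by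
  constructor
  · intro hs j hj
    obtain ⟨i, rfl, hi⟩ := h.exists_eq_one j
    simpa [blockLift, hi] using hs (show blockLift col γ v i ≠ 0 by simpa [blockLift, hi] using hj)
  · intro hs i hi
    exact mul_ne_zero (hs (left_ne_zero_of_mul hi)) (h.ne_zero i)

lemma gcd_blockLift (h : IsBlockLift A M col γ) (w : κ → ℤ) :
    Finset.univ.gcd (blockLift col γ w) = Finset.univ.gcd w := by
  refine dvd_antisymm_of_normalize_eq Finset.normalize_gcd Finset.normalize_gcd
    (Finset.dvd_gcd fun j _ => ?_) (Finset.dvd_gcd fun i _ => ?_)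
  · obtain ⟨i, rfl, hi⟩ := h.exists_eq_one j
    simpa [blockLift, hi] using Finset.gcd_dvd (f := blockLift col γ w) (Finset.mem_univ i)
  · exact (Finset.gcd_dvd (Finset.mem_univ (col i))).mul_right _

lemma blockLift_mem_circuits_iff (h : IsBlockLift A M col γ) {w : κ → ℤ} :
    blockLift col γ w ∈ circuits M ↔ w ∈ circuits A := by
  refine and_congr h.blockLift_mem_iff (and_congr h.blockLift_eq_zero_iff.not
    (and_congr (by rw [h.gcd_blockLift]) ?_))
  have hsupp {v : κ → ℤ} : Function.support (blockLift col γ v) =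
      Function.support (blockLift col γ w) ↔ Function.support v = Function.support w := by
    rw [Set.Subset.antisymm_iff, h.support_subset_iff, h.support_subset_iff,
      ← Set.Subset.antisymm_iff]
  constructor
  · intro H v hv hv0 hs
    exact hsupp.1 (H _ (h.blockLift_mem_iff.2 hv) (fun h0 => hv0 (h.blockLift_eq_zero_iff.1 h0))
      (h.support_subset_iff.2 hs))
  · intro H x hx hx0 hs
    obtain ⟨v, hv, rfl⟩ := (h.mem_kerZ_iff x).1 hx
    exact hsupp.2 (H v hv (fun h0 => hx0 (h.blockLift_eq_zero_iff.2 h0))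
      (h.support_subset_iff.1 hs))

lemma bijOn_circuits (h : IsBlockLift A M col γ) :
    Set.BijOn (blockLift col γ) (circuits A) (circuits M) := by
  refine ⟨fun w hw => h.blockLift_mem_circuits_iff.2 hw, h.injective.injOn, fun x hx => ?_⟩
  obtain ⟨w, -, rfl⟩ := (h.mem_kerZ_iff x).1 hx.1
  exact ⟨w, h.blockLift_mem_circuits_iff.1 hx, rfl⟩

lemma sum_abs_le (h : IsBlockLift A M col γ) (w : κ → ℤ) :
    ∑ j, |w j| ≤ ∑ i, |blockLift col γ w i| := by
  classical
  choose i hi hi' using h.exists_eq_one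
  have hinj : Function.Injective i := fun j k hjk => by rw [← hi j, hjk, hi k]
  calc ∑ j, |w j| = ∑ j, |blockLift col γ w (i j)| := by simp [blockLift, hi, hi']
    _ = ∑ k ∈ Finset.univ.map ⟨i, hinj⟩, |blockLift col γ w k| := by rw [Finset.sum_map]; rfl
    _ ≤ ∑ k, |blockLift col γ w k| :=
      Finset.sum_le_sum_of_subset_of_nonneg (Finset.subset_univ _) fun _ _ _ => abs_nonneg _

/-- If `z` lies in the fibre of `B(w)⁺` with `w` in the Graver basis, then `B(w)⁺ - z = B(v)` with
`B(v)⁺ ≤ B(w)⁺`. As the blocks are mixed this forces `v` to be conformal to `w`. -/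
lemma hasTwoElementFibres (h : IsBlockLift A M col γ) : HasTwoElementFibres M := by
  intro u hu z hz
  obtain ⟨w, -, rfl⟩ := (h.mem_kerZ_iff u).1 hu.1
  obtain ⟨-, -, hmin⟩ := h.blockLift_mem_graverBasis_iff.1 hu
  obtain ⟨v, hv, hvz⟩ := (h.mem_kerZ_iff _).1 hz
  have hle (i : ι) : (blockLift col γ v i).toNat ≤ (blockLift col γ w i).toNat := by
    rw [hvz]
    simp only [posExp_apply]
    omega
  have hz' (i : ι) : (z i : ℤ) = (blockLift col γ w i).toNat - blockLift col γ v i := by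
    rw [hvz]
    simp
  by_cases hv0 : v = 0
  · left
    ext i
    have := hz' i
    rw [h.blockLift_eq_zero_iff.2 hv0, Pi.zero_apply, sub_zero] at this
    exact_mod_cast this
  · right
    have hvw : v = w := hmin v hv hv0
      (posPart_le_iff.2 fun j => (h.toNat_le_of_toNat_blockLift_le hle j).1)
      (negPart_le_iff.2 fun j => (h.toNat_le_of_toNat_blockLift_le hle j).2)
    ext i
    have := hz' i
    rw [hvw] at this
    simp only [posExp_apply, Pi.neg_apply]
    omega

end IsBlockLift

end BlockLift

/-! ### Principal toric ideals -/

/-- If the kernel is generated by `c`, the toric ideal is generated by the binomial of `c`, which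
divides the binomials of all multiples of `c`. -/
lemma toricIdeal_eq_span_singleton (K : Type*) [Field K] {ρ ι : Type*} [Fintype ι]
    {M : Matrix ρ ι ℤ} {c : ι → ℤ} (hc : c ∈ kerZ M) (h : ∀ x ∈ kerZ M, ∃ k : ℤ, x = k • c) :
    toricIdeal K M = Ideal.span {toricBinomial K c} := by
  have hnat (k : ℕ) : toricBinomial K ((k : ℤ) • c) ∈ Ideal.span {toricBinomial K c} := by
    rw [Ideal.mem_span_singleton]
    have hpow (u : ι → ℤ) : (MvPolynomial.monomial (posExp ((k : ℤ) • u)) 1 : MvPolynomial ι K) =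
        MvPolynomial.monomial (posExp u) 1 ^ k := by
      rw [MvPolynomial.monomial_pow, one_pow]
      congr 2
      ext i
      simp only [posExp_apply, Pi.smul_apply, smul_eq_mul, Finsupp.smul_apply]
      rcases le_total 0 (u i) with hu | hu
      · rw [Int.toNat_mul (Int.natCast_nonneg k) hu, Int.toNat_natCast]
      · rw [Int.toNat_of_nonpos hu, mul_zero, Int.toNat_of_nonpos
          (mul_nonpos_of_nonneg_of_nonpos (Int.natCast_nonneg k) hu)]
    rw [toricBinomial_eq, toricBinomial_eq, ← smul_neg, hpow, hpow]
    exact sub_dvd_pow_sub_pow _ _ _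
  refine le_antisymm (Ideal.span_le.2 ?_) (Ideal.span_mono ?_)
  · rintro _ ⟨x, hx, rfl⟩
    obtain ⟨k, rfl⟩ := h x hx
    obtain ⟨k, rfl | rfl⟩ := k.eq_nat_or_neg
    · exact hnat k
    · rw [neg_smul, toricBinomial_neg]
      exact neg_mem (hnat k)
  · rintro _ rfl
    exact ⟨c, hc, rfl⟩

/-! ### The hypergraph of an integer matrix -/

section Construction

variable {m n : ℕ} (A : Matrix (Fin m) (Fin n) ℤ)

/-- The petals: `|A i j|` of them for the entry in position `(i, j)`. -/
abbrev Petal : Type := Σ q : Fin m × Fin n, Fin (A q.1 q.2).natAbs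

/-- The positions of the negative entries. -/
abbrev NegEntry : Type := {q : Fin m × Fin n // A q.1 q.2 < 0}

/-- The vertices of the hypergraph: one for each row, a separate core vertex for each negative
entry, and the two non-core vertices of each petal. -/
inductive Vertex : Type
  | row (i : Fin m) : Vertex
  | core (q : NegEntry A) : Vertex
  | tip (p : Petal A) (b : Bool) : Vertex

/-- The labels of the edges: petals, matching edges (also labelled by the petals), and an edge for
each negative entry that joins the row to the core vertex. -/
abbrev EdgeLabel : Type := Petal A ⊕ (Petal A ⊕ NegEntry A)

variable {A}

instance : Finite (Vertex A) := by
  let f : Fin m ⊕ NegEntry A ⊕ Petal A × Bool → Vertex A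
    | .inl i => .row i
    | .inr (.inl q) => .core q
    | .inr (.inr (p, b)) => .tip p b
  refine Finite.of_surjective f ?_
  rintro (i | q | ⟨p, b⟩)
  · exact ⟨.inl i, rfl⟩
  · exact ⟨.inr (.inl q), rfl⟩
  · exact ⟨.inr (.inr (p, b)), rfl⟩

/-- The core vertex of the sunflower of an entry: the vertex of the row for a positive entry, a
separate vertex for a negative one. -/
def coreVertex (q : Fin m × Fin n) : Vertex A :=
  if h : A q.1 q.2 < 0 then .core ⟨q, h⟩ else .row q.1

/-- The edges. The matching edges join the petals to cycles, according to a permutation `σ` of the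
petals. -/
def edge (σ : Equiv.Perm (Petal A)) : EdgeLabel A → Set (Vertex A)
  | .inl p => {coreVertex p.1, .tip p false, .tip p true}
  | .inr (.inl p) => {.tip p true, .tip (σ p) false}
  | .inr (.inr q) => {.row q.1.1, .core q}

/-- The column that an edge belongs to. -/
def edgeCol : EdgeLabel A → Fin n
  | .inl p => p.1.2
  | .inr (.inl p) => p.1.2
  | .inr (.inr q) => q.1.2

/-- The coordinate of an edge in the encoding vector of its column. -/
def edgeCoeff : EdgeLabel A → ℤ
  | .inl _ => 1
  | .inr (.inl _) => -1
  | .inr (.inr q) => A q.1.1 q.1.2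

/-- The column that a vertex belongs to; the vertices of the rows belong to none. -/
def vertexCol : Vertex A → Option (Fin n)
  | .row _ => none
  | .core q => some q.1.2
  | .tip p _ => some p.1.2

variable (A) in
/-- The basis of the bouquet of the `j`-th column. -/
def bouquetBasis (j : Fin n) : Set (Vertex A) := {x | vertexCol x = some j}

@[simp] lemma coreVertex_eq_core_iff {q : Fin m × Fin n} {q' : NegEntry A} :
    coreVertex q = Vertex.core q' ↔ q = q'.1 := by
  unfold coreVertex
  split_ifs with h
  · simp [Subtype.ext_iff]
  · simp only [false_iff]
    rintro rfl
    exact h q'.2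

@[simp] lemma coreVertex_eq_row_iff {q : Fin m × Fin n} {i : Fin m} :
    coreVertex q = (Vertex.row i : Vertex A) ↔ 0 ≤ A q.1 q.2 ∧ q.1 = i := by
  unfold coreVertex
  split_ifs with h
  · simp [h]
  · simp [not_lt.1 h]

@[simp] lemma coreVertex_ne_tip {q : Fin m × Fin n} {p : Petal A} {b : Bool} :
    coreVertex q ≠ Vertex.tip p b := by
  unfold coreVertex
  split_ifs <;> simp

lemma row_eq_of_coreVertex_eq {q q' : Fin m × Fin n}
    (h : (coreVertex q : Vertex A) = coreVertex q') : q.1 = q'.1 := by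
  unfold coreVertex at h
  split_ifs at h
  · simp only [Vertex.core.injEq, Subtype.mk.injEq] at h
    rw [h]
  · simpa using h

lemma edge_injective (σ : Equiv.Perm (Petal A)) : Function.Injective (edge σ) := by
  rintro (p | p | q) (p' | p' | q') h
  · have : Vertex.tip p true ∈ edge σ (.inl p') := h ▸ by simp [edge]
    simp only [edge, Set.mem_insert_iff, Set.mem_singleton_iff, Vertex.tip.injEq,
      coreVertex_ne_tip.symm] at this
    simp_all
  · have : coreVertex p.1 ∈ edge σ (.inr (.inl p')) := h ▸ by simp [edge]
    simp [edge] at this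
  · have : Vertex.tip p true ∈ edge σ (.inr (.inr q')) := h ▸ by simp [edge]
    simp [edge] at this
  · have : coreVertex p'.1 ∈ edge σ (.inr (.inl p)) := h ▸ by simp [edge]
    simp [edge] at this
  · have : Vertex.tip p true ∈ edge σ (.inr (.inl p')) := h ▸ by simp [edge]
    simp only [edge, Set.mem_insert_iff, Set.mem_singleton_iff, Vertex.tip.injEq] at this
    simp_all
  · have : Vertex.tip p true ∈ edge σ (.inr (.inr q')) := h ▸ by simp [edge]
    simp [edge] at this
  · have : Vertex.tip p' true ∈ edge σ (.inr (.inr q)) := h ▸ by simp [edge]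
    simp [edge] at this
  · have : Vertex.tip p' true ∈ edge σ (.inr (.inr q)) := h ▸ by simp [edge]
    simp [edge] at this
  · have : Vertex.core q ∈ edge σ (.inr (.inr q')) := h ▸ by simp [edge]
    simp only [edge, Set.mem_insert_iff, Set.mem_singleton_iff, Vertex.core.injEq,
      reduceCtorEq, false_or] at this
    rw [this]

lemma vertexCol_coreVertex (q : Fin m × Fin n) :
    vertexCol (coreVertex q : Vertex A) = none ∨
      vertexCol (coreVertex q : Vertex A) = some q.2 := by
  unfold coreVertex
  split_ifs <;> simp [vertexCol]

lemma edge_inter_bouquetBasis_nonempty_iff {σ : Equiv.Perm (Petal A)}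
    (hσ : ∀ p, (σ p).1.2 = p.1.2) {e : EdgeLabel A} {j : Fin n} :
    (edge σ e ∩ bouquetBasis A j).Nonempty ↔ edgeCol e = j := by
  constructor
  · rintro ⟨x, hx, hxj⟩
    rcases e with p | p | q
    · rcases hx with rfl | rfl | rfl
      · rcases vertexCol_coreVertex (A := A) p.1 with h | h <;>
          simp_all [bouquetBasis, edgeCol]
      · simpa [bouquetBasis, vertexCol, edgeCol] using hxj
      · simpa [bouquetBasis, vertexCol, edgeCol] using hxj
    · rcases hx with rfl | rfl
      · simpa [bouquetBasis, vertexCol, edgeCol] using hxj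
      · simpa [bouquetBasis, vertexCol, edgeCol, hσ] using hxj
    · rcases hx with rfl | rfl
      · simp [bouquetBasis, vertexCol] at hxj
      · simpa [bouquetBasis, vertexCol, edgeCol] using hxj
  · rintro rfl
    rcases e with p | p | q
    · exact ⟨.tip p true, by simp [edge], rfl⟩
    · exact ⟨.tip p true, by simp [edge], rfl⟩
    · exact ⟨.core q, by simp [edge], rfl⟩

lemma exists_petal {i : Fin m} {j : Fin n} (h : A i j ≠ 0) : ∃ p : Petal A, p.1 = (i, j) :=
  ⟨⟨(i, j), ⟨0, Int.natAbs_pos.2 h⟩⟩, rfl⟩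

/-- There is a permutation whose orbits are the fibres of a given map. -/
lemma exists_perm_sameCycle_iff {α β : Type*} [Finite α] (f : α → β) :
    ∃ σ : Equiv.Perm α, ∀ x y, σ.SameCycle x y ↔ f x = f y := by
  classical
  have := Fintype.ofFinite α
  choose τ hτ _ using fun b => (Finset.univ : Finset {x // f x = b}).exists_cycleOn
  let s := Equiv.sigmaFiberEquiv f
  let ρ : Equiv.Perm (Σ b, {x // f x = b}) := Equiv.Perm.sigmaCongrRight τ
  have hpow (k : ℤ) (b : β) (x : {x // f x = b}) : (ρ ^ k) ⟨b, x⟩ = ⟨b, (τ b ^ k) x⟩ := by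
    have : ρ ^ k = Equiv.Perm.sigmaCongrRight (τ ^ k) :=
      (map_zpow (Equiv.Perm.sigmaCongrRightHom _) τ k).symm
    rw [this]
    rfl
  refine ⟨s.permCongr ρ, fun x y => ?_⟩
  have hconj (k : ℤ) : (s.permCongr ρ ^ k) x = s ((ρ ^ k) (s.symm x)) := by
    have : s.permCongr ρ ^ k = s.permCongr (ρ ^ k) := (map_zpow s.permCongrHom ρ k).symm
    rw [this, Equiv.permCongr_apply]
  constructor
  · rintro ⟨k, rfl⟩
    rw [hconj]
    change f x = f (s ((ρ ^ k) ⟨f x, x, rfl⟩))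
    rw [hpow]
    exact ((τ (f x) ^ k) ⟨x, rfl⟩).2.symm
  · intro h
    obtain ⟨k, hk⟩ := (hτ (f x)).2 (x := ⟨x, rfl⟩) (by simp) (y := ⟨y, h.symm⟩) (by simp)
    refine ⟨k, ?_⟩
    rw [hconj]
    change s ((ρ ^ k) ⟨f x, x, rfl⟩) = y
    rw [hpow, hk]
    rfl

lemma col_apply_eq {σ : Equiv.Perm (Petal A)}
    (hσ : ∀ p p', σ.SameCycle p p' ↔ p.1.2 = p'.1.2) (p : Petal A) : (σ p).1.2 = p.1.2 := by
  rw [eq_comm, ← hσ]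
  exact ⟨1, by simp⟩

/-- A numbering of `α ⊕ β` in which the elements of `α` come first. -/
lemma exists_fin_equiv_sum (α β : Type*) [Fintype α] [Fintype β] :
    ∃ (N : ℕ) (ε : Fin N ≃ α ⊕ β), ∀ i k, i ≤ k → (ε k).isLeft → (ε i).isLeft := by
  refine ⟨_, finSumFinEquiv.symm.trans
    (Equiv.sumCongr (Fintype.equivFin α).symm (Fintype.equivFin β).symm), fun i k hik => ?_⟩
  obtain ⟨i, rfl⟩ := finSumFinEquiv.surjective i
  obtain ⟨k, rfl⟩ := finSumFinEquiv.surjective k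
  rcases i with i | i <;> rcases k with k | k
  · simp
  · simp
  · rw [Fin.le_def] at hik
    simp only [finSumFinEquiv_apply_left, finSumFinEquiv_apply_right, Fin.val_castAdd,
      Fin.val_natAdd] at hik
    omega
  · simp

/-! ### The kernel of the incidence matrix -/

open scoped Classical in
/-- The sum of the weights `F` of the edges that contain the vertex `x`. -/
noncomputable def weightedDegree (σ : Equiv.Perm (Petal A)) (F : EdgeLabel A → ℤ)
    (x : Vertex A) : ℤ :=
  ∑ e, if x ∈ edge σ e then F e else 0

variable {σ : Equiv.Perm (Petal A)} {F : EdgeLabel A → ℤ}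

open scoped Classical in
lemma weightedDegree_eq (x : Vertex A) : weightedDegree σ F x =
    (∑ p, if x ∈ edge σ (.inl p) then F (.inl p) else 0) +
      ((∑ p, if x ∈ edge σ (.inr (.inl p)) then F (.inr (.inl p)) else 0) +
        ∑ q, if x ∈ edge σ (.inr (.inr q)) then F (.inr (.inr q)) else 0) := by
  rw [weightedDegree, Fintype.sum_sum_type, Fintype.sum_sum_type]

lemma weightedDegree_tip_true (p : Petal A) :
    weightedDegree σ F (.tip p true) = F (.inl p) + F (.inr (.inl p)) := by
  classical
  rw [weightedDegree_eq]
  simp [edge, coreVertex_ne_tip.symm]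

lemma weightedDegree_tip_false (p : Petal A) :
    weightedDegree σ F (.tip p false) = F (.inl p) + F (.inr (.inl (σ.symm p))) := by
  classical
  rw [weightedDegree_eq]
  simp [edge, coreVertex_ne_tip.symm, ← Equiv.symm_apply_eq]

lemma weightedDegree_core (q : NegEntry A) :
    weightedDegree σ F (.core q) = ∑ t, F (.inl ⟨q.1, t⟩) + F (.inr (.inr q)) := by
  classical
  rw [weightedDegree_eq]
  simp only [edge, Set.mem_insert_iff, Set.mem_singleton_iff, reduceCtorEq, or_false, false_or,
    if_false, Finset.sum_const_zero, zero_add, Vertex.core.injEq,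
    eq_comm (a := Vertex.core q), coreVertex_eq_core_iff]
  rw [Fintype.sum_sigma, Finset.sum_eq_single q.1]
  · simp
  · intro q' _ h
    simp [h]
  · simp

lemma weightedDegree_row (i : Fin m) :
    weightedDegree σ F (.row i) = ∑ j, ((if 0 ≤ A i j then ∑ t, F (.inl ⟨(i, j), t⟩) else 0) +
      if h : A i j < 0 then F (.inr (.inr ⟨(i, j), h⟩)) else 0) := by
  classical
  rw [weightedDegree_eq]
  simp only [edge, Set.mem_insert_iff, Set.mem_singleton_iff, reduceCtorEq, or_false,
    if_false, Finset.sum_const_zero, zero_add, Vertex.row.injEq,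
    eq_comm (a := Vertex.row i), coreVertex_eq_row_iff]
  rw [Finset.sum_add_distrib]
  congr 1
  · rw [Fintype.sum_sigma, Fintype.sum_prod_type, Finset.sum_eq_single i]
    · refine Finset.sum_congr rfl fun j _ => ?_
      split_ifs with h <;> simp [h]
    · intro i' _ h
      simp [h]
    · simp
  · let G : Fin m × Fin n → ℤ := fun q =>
      if h : A q.1 q.2 < 0 then (if q.1 = i then F (.inr (.inr ⟨q, h⟩)) else 0) else 0
    calc ∑ q : NegEntry A, (if q.1.1 = i then F (.inr (.inr q)) else 0)
        = ∑ q : NegEntry A, G q.1 := by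
          refine Finset.sum_congr rfl fun q _ => ?_
          simp [G, q.2]
      _ = ∑ q with A q.1 q.2 < 0, G q :=
          (Finset.sum_subtype (p := fun q : Fin m × Fin n => A q.1 q.2 < 0) _ (by simp) G).symm
      _ = ∑ q, G q := by
          refine Finset.sum_subset (Finset.subset_univ _) fun q _ hq => ?_
          simp only [Finset.mem_filter, Finset.mem_univ, true_and] at hq
          simp [G, hq]
      _ = _ := by
          rw [Fintype.sum_prod_type, Finset.sum_eq_single i]
          · simp [G]
          · intro i' _ h
            simp [G, h]
          · simp

/-- On the bouquet of a column, the edge weights with vanishing weighted degrees are the multiples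
of the encoding vector. -/
lemma exists_eq_mul_edgeCoeff (hσ : ∀ p p', σ.SameCycle p p' ↔ p.1.2 = p'.1.2) {j : Fin n}
    (hj : ∃ i, A i j ≠ 0) (hF : ∀ x ∈ bouquetBasis A j, weightedDegree σ F x = 0) :
    ∃ k : ℤ, ∀ e, edgeCol e = j → F e = k * edgeCoeff e := by
  obtain ⟨i, hi⟩ := hj
  obtain ⟨p₀, hp₀⟩ := exists_petal hi
  have hlink (p : Petal A) (hp : p.1.2 = j) : F (.inr (.inl p)) = -F (.inl p) := by
    have := hF (.tip p true) (congrArg some hp)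
    rw [weightedDegree_tip_true] at this
    linarith
  have hstep (p : Petal A) (hp : p.1.2 = j) : F (.inl (σ p)) = F (.inl p) := by
    have hcol : (σ p).1.2 = j := (col_apply_eq hσ p).trans hp
    have := hF (.tip (σ p) false) (congrArg some hcol)
    rw [weightedDegree_tip_false, Equiv.symm_apply_apply, hlink p hp] at this
    linarith
  have hpetal (p : Petal A) (hp : p.1.2 = j) : F (.inl p) = F (.inl p₀) := by
    obtain ⟨k, rfl⟩ := ((hσ p₀ p).2 (by rw [hp, hp₀])).exists_nat_pow_eq
    clear hp
    have : ((σ ^ k) p₀).1.2 = j ∧ F (.inl ((σ ^ k) p₀)) = F (.inl p₀) := by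
      induction k with
      | zero => simp [hp₀]
      | succ k ih =>
        rw [pow_succ', Equiv.Perm.mul_apply, hstep _ ih.1]
        exact ⟨(col_apply_eq hσ _).trans ih.1, ih.2⟩
    exact this.2
  refine ⟨F (.inl p₀), ?_⟩
  rintro (p | p | q) he
  · simp [hpetal p he, edgeCoeff]
  · simp [hlink p he, hpetal p he, edgeCoeff]
  · have := hF (.core q) (congrArg some he)
    rw [weightedDegree_core, Finset.sum_congr rfl fun t _ => hpetal ⟨q.1, t⟩ he] at this
    simp only [Finset.sum_const, Finset.card_univ, Fintype.card_fin, nsmul_eq_mul] at this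
    have hq := q.2
    have habs : ((A q.1.1 q.1.2).natAbs : ℤ) = -A q.1.1 q.1.2 := by omega
    rw [habs] at this
    simp only [edgeCoeff]
    linarith

lemma weightedDegree_blockLift (hσ : ∀ p, (σ p).1.2 = p.1.2) (w : Fin n → ℤ) :
    (∀ x, vertexCol x ≠ none → weightedDegree σ (blockLift edgeCol edgeCoeff w) x = 0) ∧
      ∀ i, weightedDegree σ (blockLift edgeCol edgeCoeff w) (.row i) = (A *ᵥ w) i := by
  constructor
  · rintro (i | q | ⟨p, b⟩) hx
    · exact absurd rfl hx
    · rw [weightedDegree_core]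
      have hq := q.2
      have habs : ((A q.1.1 q.1.2).natAbs : ℤ) = -A q.1.1 q.1.2 := by omega
      simp only [blockLift, edgeCol, edgeCoeff, Finset.sum_const, Finset.card_univ,
        Fintype.card_fin, nsmul_eq_mul, habs]
      ring
    · cases b
      · have hcol : (σ.symm p).1.2 = p.1.2 := by
          rw [← hσ, Equiv.apply_symm_apply]
        rw [weightedDegree_tip_false]
        simp [blockLift, edgeCol, edgeCoeff, hcol]
      · rw [weightedDegree_tip_true]
        simp [blockLift, edgeCol, edgeCoeff]
  · intro i
    rw [weightedDegree_row, Matrix.mulVec, dotProduct]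
    refine Finset.sum_congr rfl fun j _ => ?_
    rcases lt_or_ge (A i j) 0 with h | h
    · simp [blockLift, edgeCol, edgeCoeff, h, not_le.2 h, mul_comm]
    · have habs : ((A i j).natAbs : ℤ) = A i j := by omega
      simp only [if_pos h, dif_neg (not_lt.2 h), blockLift, edgeCol, edgeCoeff, Finset.sum_const,
        Finset.card_univ, Fintype.card_fin, nsmul_eq_mul, habs]
      ring

end Construction

/-! ### Sunflowers, matchings and connectedness -/

section Sunflowers

variable {m n : ℕ} {A : Matrix (Fin m) (Fin n) ℤ} {σ : Equiv.Perm (Petal A)}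

/-- The sunflower of the entry in position `(i, j)`; it has no petals if the entry is zero. -/
def sunflower (σ : Equiv.Perm (Petal A)) (i : Fin m) (j : Fin n) : Set (Set (Vertex A)) :=
  Set.range fun t : Fin (A i j).natAbs => edge σ (.inl ⟨(i, j), t⟩)

/-- The matching edges of the `j`-th column. -/
def matchingEdges (σ : Equiv.Perm (Petal A)) (j : Fin n) : Set (Set (Vertex A)) :=
  {e | ∃ p : Petal A, p.1.2 = j ∧ edge σ (.inr (.inl p)) = e}

variable (A) in
/-- The non-core vertices of the sunflowers of the `j`-th column. -/
def tips (j : Fin n) : Set (Vertex A) :=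
  {x | ∃ (p : Petal A) (b : Bool), p.1.2 = j ∧ Vertex.tip p b = x}

lemma tip_mem_tips {p : Petal A} {b : Bool} {j : Fin n} : .tip p b ∈ tips A j ↔ p.1.2 = j := by
  simp only [tips, Set.mem_ofPred_eq, Vertex.tip.injEq]
  constructor
  · rintro ⟨p', b', h, rfl, rfl⟩
    exact h
  · exact fun h => ⟨p, b, h, rfl, rfl⟩

lemma mem_sUnion_sunflower {i : Fin m} {j : Fin n} {x : Vertex A} :
    x ∈ ⋃₀ sunflower σ i j ↔
      (A i j ≠ 0 ∧ x = coreVertex (i, j)) ∨ ∃ t b, x = .tip ⟨(i, j), t⟩ b := by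
  simp only [sunflower, Set.sUnion_range, Set.mem_iUnion, edge, Set.mem_insert_iff,
    Set.mem_singleton_iff]
  constructor
  · rintro ⟨t, rfl | rfl | rfl⟩
    · exact Or.inl ⟨Int.natAbs_pos.1 t.pos, rfl⟩
    · exact Or.inr ⟨t, _, rfl⟩
    · exact Or.inr ⟨t, _, rfl⟩
  · rintro (⟨h, rfl⟩ | ⟨t, b, rfl⟩)
    · exact ⟨⟨0, Int.natAbs_pos.2 h⟩, Or.inl rfl⟩
    · exact ⟨t, by cases b <;> simp⟩

lemma iUnion_sunflower_diff_core (j : Fin n) :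
    (⋃ i : {i // A i j ≠ 0}, (⋃₀ sunflower σ i.1 j \ {coreVertex (i.1, j)})) = tips A j := by
  ext x
  simp only [Set.mem_iUnion, Set.mem_sdiff, mem_sUnion_sunflower, Set.mem_singleton_iff]
  constructor
  · rintro ⟨i, ⟨-, rfl⟩ | ⟨t, b, rfl⟩, h⟩
    · exact absurd rfl h
    · exact tip_mem_tips.2 rfl
  · rintro ⟨⟨⟨i, j⟩, t⟩, b, rfl, rfl⟩
    exact ⟨⟨i, Int.natAbs_pos.1 t.pos⟩, Or.inr ⟨t, b, rfl⟩, coreVertex_ne_tip.symm⟩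

lemma isSunflower_sunflower (i : Fin m) (j : Fin n) :
    IsSunflower (sunflower σ i j) {coreVertex (i, j)} := by
  constructor
  · rintro _ ⟨t, rfl⟩
    refine ⟨by simp [edge], fun h => ?_⟩
    have := h (show Vertex.tip ⟨(i, j), t⟩ true ∈ _ by simp [edge])
    exact coreVertex_ne_tip (Set.mem_singleton_iff.1 this).symm
  · rintro _ ⟨t, rfl⟩ _ ⟨t', rfl⟩ hne
    have htt : t ≠ t' := by
      rintro rfl
      exact hne rfl
    ext x
    simp only [edge, Set.mem_inter_iff, Set.mem_insert_iff, Set.mem_singleton_iff]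
    constructor
    · rintro ⟨rfl | rfl | rfl, h⟩
      · rfl
      · simp [coreVertex_ne_tip.symm, htt] at h
      · simp [coreVertex_ne_tip.symm, htt] at h
    · rintro rfl
      simp

lemma disjoint_sunflower {i k : Fin m} (j : Fin n) (hik : i ≠ k) :
    Disjoint (⋃₀ sunflower σ i j) (⋃₀ sunflower σ k j) := by
  rw [Set.disjoint_left]
  intro x hx hx'
  rw [mem_sUnion_sunflower] at hx hx'
  rcases hx with ⟨-, rfl⟩ | ⟨t, b, rfl⟩
  · rcases hx' with ⟨-, h⟩ | ⟨t, b, h⟩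
    · exact hik (row_eq_of_coreVertex_eq h)
    · exact coreVertex_ne_tip h
  · rcases hx' with ⟨-, h⟩ | ⟨t', b', h⟩
    · exact coreVertex_ne_tip h.symm
    · simp only [Vertex.tip.injEq, Sigma.mk.injEq, Prod.mk.injEq] at h
      exact hik h.1.1.1

lemma isPerfectMatching_matchingEdges (hσ : ∀ p, (σ p).1.2 = p.1.2) (j : Fin n) :
    IsPerfectMatching (matchingEdges σ j) (tips A j) := by
  constructor
  · rintro _ ⟨p, -, rfl⟩ _ ⟨p', -, rfl⟩ hne
    have hpp : p ≠ p' := by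
      rintro rfl
      exact hne rfl
    rw [Function.onFun, id, id, Set.disjoint_left]
    rintro x (rfl | rfl) h
    · simp [edge, hpp] at h
    · simp [edge, hpp] at h
  · ext x
    constructor
    · rintro ⟨_, ⟨p, hp, rfl⟩, rfl | rfl⟩
      · exact tip_mem_tips.2 hp
      · exact tip_mem_tips.2 ((hσ p).trans hp)
    · rintro ⟨p, b, hp, rfl⟩
      cases b
      · refine ⟨_, ⟨σ.symm p, ?_, rfl⟩, ?_⟩
        · rw [← hσ, Equiv.apply_symm_apply, hp]
        · simp [edge]
      · exact ⟨_, ⟨p, hp, rfl⟩, by simp [edge]⟩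

/-- Removing the cores leaves the cycle that alternates between petals and matching edges. -/
lemma connected_primalGraph (hσ : ∀ p p', σ.SameCycle p p' ↔ p.1.2 = p'.1.2) {j : Fin n}
    (hj : ∃ i, A i j ≠ 0) :
    (primalGraph ((⋃ i : {i // A i j ≠ 0}, sunflower σ i.1 j) ∪ matchingEdges σ j)
      (tips A j)).Connected := by
  obtain ⟨i, hi⟩ := hj
  obtain ⟨p₀, hp₀⟩ := exists_petal hi
  have hp₀j : p₀.1.2 = j := by rw [hp₀]
  set G := primalGraph ((⋃ i : {i // A i j ≠ 0}, sunflower σ i.1 j) ∪ matchingEdges σ j)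
    (tips A j) with hG
  have hpetal (p : Petal A) (hp : p.1.2 = j) :
      G.Adj ⟨.tip p false, tip_mem_tips.2 hp⟩ ⟨.tip p true, tip_mem_tips.2 hp⟩ := by
    rw [hG, primalGraph, SimpleGraph.fromRel_adj]
    refine ⟨by simp, Or.inl ⟨edge σ (.inl p), Or.inl ?_, by simp [edge], by simp [edge]⟩⟩
    obtain ⟨⟨i, j⟩, t⟩ := p
    subst hp
    exact Set.mem_iUnion.2 ⟨⟨i, Int.natAbs_pos.1 t.pos⟩, t, rfl⟩
  have hcol (p : Petal A) (hp : p.1.2 = j) : (σ p).1.2 = j := (col_apply_eq hσ p).trans hp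
  have hlink (p : Petal A) (hp : p.1.2 = j) :
      G.Adj ⟨.tip p true, tip_mem_tips.2 hp⟩ ⟨.tip (σ p) false, tip_mem_tips.2 (hcol p hp)⟩ := by
    rw [hG, primalGraph, SimpleGraph.fromRel_adj]
    exact ⟨by simp, Or.inl ⟨edge σ (.inr (.inl p)), Or.inr ⟨p, hp, rfl⟩, by simp [edge],
      by simp [edge]⟩⟩
  have hpow (k : ℕ) : ∃ h : ((σ ^ k) p₀).1.2 = j,
      G.Reachable ⟨.tip p₀ false, tip_mem_tips.2 hp₀j⟩
        ⟨.tip ((σ ^ k) p₀) false, tip_mem_tips.2 h⟩ := by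
    induction k with
    | zero => exact ⟨hp₀j, .refl _⟩
    | succ k ih =>
      obtain ⟨h, hr⟩ := ih
      simp only [pow_succ', Equiv.Perm.mul_apply]
      exact ⟨hcol _ h, (hr.trans (hpetal _ h).reachable).trans (hlink _ h).reachable⟩
  rw [SimpleGraph.connected_iff_exists_forall_reachable]
  refine ⟨⟨.tip p₀ false, tip_mem_tips.2 hp₀j⟩, ?_⟩
  rintro ⟨_, p, b, hp, rfl⟩
  obtain ⟨k, rfl⟩ := ((hσ p₀ p).2 (hp₀j.trans hp.symm)).exists_nat_pow_eq
  obtain ⟨h, hr⟩ := hpow k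
  cases b
  · exact hr
  · exact hr.trans (hpetal _ h).reachable

variable (σ) in
/-- The hypergraph of the integer matrix `A`. -/
def sunflowerHypergraph : Hypergraph (Vertex A) where
  vertexSet := Set.univ
  edgeSet := Set.range (edge σ)
  subset_vertexSet_of_mem_edgeSet' _ _ := Set.subset_univ _

lemma ncard_edge_petal (p : Petal A) : (edge σ (.inl p)).ncard = 3 :=
  Set.ncard_eq_three.2 ⟨_, _, _, coreVertex_ne_tip, coreVertex_ne_tip, by simp, rfl⟩

lemma ncard_edge_link (p : Petal A) : (edge σ (.inr (.inl p))).ncard = 2 :=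
  Set.ncard_eq_two.2 ⟨_, _, by simp, rfl⟩

lemma ncard_edge_pendant (q : NegEntry A) : (edge σ (.inr (.inr q))).ncard = 2 :=
  Set.ncard_eq_two.2 ⟨_, _, by simp, rfl⟩

lemma isAlmostThreeUniform_sunflowerHypergraph (h : ∃ i j, A i j ≠ 0) :
    IsAlmostThreeUniform (sunflowerHypergraph σ) := by
  constructor
  · rintro _ ⟨e, rfl⟩
    have hcard : 2 ≤ (edge σ e).ncard ∧ (edge σ e).ncard ≤ 3 := by
      rcases e with p | p | q
      · rw [ncard_edge_petal]; omega
      · rw [ncard_edge_link]; omega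
      · rw [ncard_edge_pendant]; omega
    exact ⟨Set.toFinite _, Set.nonempty_of_ncard_ne_zero (by omega), hcard.2⟩
  · obtain ⟨i, j, hij⟩ := h
    obtain ⟨p, -⟩ := exists_petal hij
    exact ⟨_, ⟨.inl p, rfl⟩, ncard_edge_petal p⟩

lemma row_injective : Function.Injective (Vertex.row : Fin m → Vertex A) :=
  fun _ _ h => Vertex.row.inj h

lemma isBuiltFromMatchedSunflowers (hσ : ∀ p p', σ.SameCycle p p' ↔ p.1.2 = p'.1.2)
    (hcol : ∀ j, ∃ i, A i j ≠ 0) :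
    IsBuiltFromMatchedSunflowers A (sunflowerHypergraph σ) Vertex.row (bouquetBasis A) := by
  have hσ' : ∀ p, (σ p).1.2 = p.1.2 := col_apply_eq hσ
  refine ⟨sunflower σ, fun i j => coreVertex (i, j), matchingEdges σ, ?_, ?_, ?_, ?_, ?_, ?_, ?_⟩
  · intro i j _
    constructor
    · rw [sunflower, Set.ncard_range_of_injective, Nat.card_fin]
      intro t t' h
      simpa using edge_injective σ h
    · rintro _ ⟨t, rfl⟩
      refine ⟨ncard_edge_petal _, ?_⟩
      rintro _ ⟨rfl | rfl | rfl, k, hk⟩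
      · rfl
      · simp at hk
      · simp at hk
  · intro i j h
    exact coreVertex_eq_row_iff.2 ⟨h.le, rfl⟩
  · rintro i j h ⟨k, hk⟩
    exact absurd (coreVertex_eq_row_iff.1 hk.symm).1 (not_le.2 h)
  · rintro j _ ⟨p, -, rfl⟩
    exact ncard_edge_link p
  · intro j
    refine ⟨fun i => isSunflower_sunflower i.1 j,
      fun i k hik => disjoint_sunflower j (fun h => hik (Subtype.ext h)), ?_, ?_⟩
    · rw [iUnion_sunflower_diff_core]
      exact isPerfectMatching_matchingEdges hσ' j
    · rw [iUnion_sunflower_diff_core]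
      exact connected_primalGraph hσ (hcol j)
  · intro j
    ext x
    simp only [Set.mem_sdiff, Set.mem_iUnion, mem_sUnion_sunflower, bouquetBasis,
      Set.mem_ofPred_eq]
    constructor
    · intro hx
      rcases x with i | ⟨⟨i, j'⟩, h⟩ | ⟨⟨⟨i, j'⟩, t⟩, b⟩
      · simp [vertexCol] at hx
      · obtain rfl : j' = j := by simpa [vertexCol] using hx
        exact ⟨⟨⟨i, h.ne⟩, Or.inl ⟨h.ne, (coreVertex_eq_core_iff.2 rfl).symm⟩⟩, by simp⟩
      · obtain rfl : j' = j := by simpa [vertexCol] using hx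
        exact ⟨⟨⟨i, Int.natAbs_pos.1 t.pos⟩, Or.inr ⟨t, b, rfl⟩⟩, by simp⟩
    · rintro ⟨⟨i, ⟨-, rfl⟩ | ⟨t, b, rfl⟩⟩, hx⟩
      · rcases lt_or_ge (A i.1 j) 0 with h | h
        · rw [show coreVertex (i.1, j) = Vertex.core ⟨(i.1, j), h⟩ by simp]
          rfl
        · exact absurd ⟨i.1, ((coreVertex_eq_row_iff (q := (i.1, j))).2 ⟨h, rfl⟩).symm⟩ hx
      · rfl
  · intro j
    ext e
    simp only [Set.mem_ofPred_eq, Set.mem_union, Set.mem_iUnion]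
    constructor
    · rintro ⟨⟨e, rfl⟩, he⟩
      rw [edge_inter_bouquetBasis_nonempty_iff hσ'] at he
      subst he
      rcases e with ⟨⟨i, j⟩, t⟩ | p | q
      · exact Or.inl (Or.inl ⟨⟨i, Int.natAbs_pos.1 t.pos⟩, t, rfl⟩)
      · exact Or.inl (Or.inr ⟨p, rfl, rfl⟩)
      · exact Or.inr ⟨q.1.1, q.2, by
          rw [edge, edgeCol, (coreVertex_eq_core_iff (q' := q)).2 rfl]⟩
    · rintro ((⟨i, t, rfl⟩ | ⟨p, hp, rfl⟩) | ⟨i, h, rfl⟩)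
      · exact ⟨⟨_, rfl⟩, (edge_inter_bouquetBasis_nonempty_iff hσ').2 rfl⟩
      · exact ⟨⟨_, rfl⟩, (edge_inter_bouquetBasis_nonempty_iff hσ').2 hp⟩
      · have : ({Vertex.row i, coreVertex (i, j)} : Set (Vertex A)) =
            edge σ (.inr (.inr ⟨(i, j), h⟩)) := by
          rw [edge, (coreVertex_eq_core_iff (q' := ⟨(i, j), h⟩)).2 rfl]
        rw [this]
        exact ⟨⟨_, rfl⟩, (edge_inter_bouquetBasis_nonempty_iff hσ').2 rfl⟩

end Sunflowers

/-! ### Bouquets and the kernel for a numbering of the edges -/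

section Numbering

variable {m n N : ℕ} {A : Matrix (Fin m) (Fin n) ℤ} {σ : Equiv.Perm (Petal A)}
  (ε : Fin N ≃ EdgeLabel A)

lemma incidenceMatrix_mulVec (F : EdgeLabel A → ℤ) (x : Vertex A) :
    (incidenceMatrix (fun i => edge σ (ε i)) *ᵥ (F ∘ ε)) x = weightedDegree σ F x := by
  classical
  simp only [incidenceMatrix, Matrix.mulVec, dotProduct, Matrix.of_apply, Function.comp_apply,
    ite_mul, one_mul, zero_mul]
  rw [weightedDegree, ← Equiv.sum_comp ε]

lemma incidenceMatrix_restrictTo_mulVec (U : Set (Vertex A))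
    [Fintype {i // (edge σ (ε i) ∩ U).Nonempty}] (F : EdgeLabel A → ℤ) (x : U) :
    (incidenceMatrix (restrictTo (fun i => edge σ (ε i)) U) *ᵥ fun i => F (ε i.1)) x =
      weightedDegree σ F x := by
  classical
  rw [← incidenceMatrix_mulVec ε]
  have hsub := Finset.sum_subtype {i | (edge σ (ε i) ∩ U).Nonempty}
    (p := fun i => (edge σ (ε i) ∩ U).Nonempty) (F := inferInstance) (by simp)
    fun i => if (x : Vertex A) ∈ edge σ (ε i) then F (ε i) else 0
  have hall : (incidenceMatrix (fun i => edge σ (ε i)) *ᵥ (F ∘ ε)) (x : Vertex A) =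
      ∑ i, if (x : Vertex A) ∈ edge σ (ε i) then F (ε i) else 0 := by
    simp [incidenceMatrix, Matrix.mulVec, dotProduct]
  rw [hall, ← Finset.sum_subset (Finset.subset_univ {i | (edge σ (ε i) ∩ U).Nonempty}), hsub]
  · refine Finset.sum_congr rfl fun i _ => ?_
    by_cases h : (x : Vertex A) ∈ edge σ (ε i.1)
    · exact (congrArg (· * F (ε i.1)) (if_pos h)).trans ((one_mul _).trans (if_pos h).symm)
    · exact (congrArg (· * F (ε i.1)) (if_neg h)).trans ((zero_mul _).trans (if_neg h).symm)
  · refine fun i _ hi => if_neg fun hx => hi ?_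
    exact Finset.mem_filter.2 ⟨Finset.mem_univ _, x, hx, x.2⟩

/-- The encoding vector of the bouquet of the `j`-th column. -/
def encodingVector (j : Fin n) : Fin N → ℤ :=
  blockLift edgeCol edgeCoeff (Pi.single j 1) ∘ ε

lemma bouquetMap_encodingVector (u : Fin n → ℤ) :
    bouquetMap (encodingVector ε) u = blockLift edgeCol edgeCoeff u ∘ ε := by
  ext i
  simp [bouquetMap, encodingVector, blockLift, Pi.single_apply]

lemma edgeCoeff_ne_zero (e : EdgeLabel A) : edgeCoeff e ≠ 0 := by
  rcases e with p | p | q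
  · exact one_ne_zero
  · simp [edgeCoeff]
  · exact q.2.ne

lemma mem_kerZ_iff {ρ ι : Type*} [Fintype ι] {M : Matrix ρ ι ℤ} {x : ι → ℤ} :
    x ∈ kerZ M ↔ ∀ r, (M *ᵥ x) r = 0 := by
  rw [kerZ, LinearMap.mem_ker, Matrix.mulVecLin_apply, funext_iff]
  rfl

lemma isBlockLift (hσ : ∀ p p', σ.SameCycle p p' ↔ p.1.2 = p'.1.2) (hcol : ∀ j, ∃ i, A i j ≠ 0) :
    IsBlockLift A (incidenceMatrix fun i => edge σ (ε i)) (edgeCol ∘ ε) (edgeCoeff ∘ ε) := by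
  have hσ' : ∀ p, (σ p).1.2 = p.1.2 := col_apply_eq hσ
  refine ⟨fun x => ?_, fun i => edgeCoeff_ne_zero _, fun j => ?_, fun j => ?_⟩
  · obtain ⟨F, rfl⟩ : ∃ F : EdgeLabel A → ℤ, x = F ∘ ε := ⟨x ∘ ε.symm, by ext; simp⟩
    simp only [mem_kerZ_iff, incidenceMatrix_mulVec]
    constructor
    · intro hF
      choose w hw using fun j => exists_eq_mul_edgeCoeff hσ (hcol j) fun x _ => hF x
      obtain rfl : F = blockLift edgeCol edgeCoeff w := by
        ext e
        exact hw _ e rfl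
      exact ⟨w, fun i => by rw [← (weightedDegree_blockLift hσ' w).2]; exact hF _, rfl⟩
    · rintro ⟨w, hw, hwF⟩ x
      obtain rfl : blockLift edgeCol edgeCoeff w = F := by
        ext e
        obtain ⟨i, rfl⟩ := ε.surjective e
        exact congr_fun hwF i
      by_cases hx : vertexCol x = none
      · rcases x with i | q | ⟨p, b⟩
        · rw [(weightedDegree_blockLift hσ' w).2, hw]
        · simp [vertexCol] at hx
        · simp [vertexCol] at hx
      · exact (weightedDegree_blockLift hσ' w).1 x hx
  · obtain ⟨i, hi⟩ := hcol j
    obtain ⟨p, hp⟩ := exists_petal hi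
    exact ⟨ε.symm (.inl p), by simp [edgeCol, hp], by simp [edgeCoeff]⟩
  · obtain ⟨i, hi⟩ := hcol j
    obtain ⟨p, hp⟩ := exists_petal hi
    exact ⟨ε.symm (.inr (.inl p)), by simp [edgeCol, hp], by simp [edgeCoeff]⟩

lemma isBouquetWithBasis (K : Type*) [Field K]
    (hσ : ∀ p p', σ.SameCycle p p' ↔ p.1.2 = p'.1.2) (hcol : ∀ j, ∃ i, A i j ≠ 0)
    (hε : ∀ i k, i ≤ k → (ε k).isLeft → (ε i).isLeft) (j : Fin n) :
    IsBouquetWithBasis K (fun i => edge σ (ε i)) (bouquetBasis A j) (encodingVector ε j) := by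
  classical
  have hσ' : ∀ p, (σ p).1.2 = p.1.2 := col_apply_eq hσ
  have happly (i : Fin N) : encodingVector ε j i =
      if edgeCol (ε i) = j then edgeCoeff (ε i) else 0 := by
    simp [encodingVector, blockLift, Pi.single_apply]
  refine ⟨fun i => ?_, ?_, ?_⟩
  · rw [edge_inter_bouquetBasis_nonempty_iff hσ', happly]
    split_ifs with h <;> simp [h, edgeCoeff_ne_zero]
  · refine toricIdeal_eq_span_singleton K ?_ ?_
    · rw [mem_kerZ_iff]
      intro x
      refine (incidenceMatrix_restrictTo_mulVec ε _
        (blockLift edgeCol edgeCoeff (Pi.single j 1)) x).trans ?_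
      refine (weightedDegree_blockLift hσ' _).1 x ?_
      rw [show vertexCol x.1 = some j from x.2]
      simp
    · intro x hx
      let F : EdgeLabel A → ℤ := fun e =>
        if h : (edge σ (ε (ε.symm e)) ∩ bouquetBasis A j).Nonempty then x ⟨ε.symm e, h⟩ else 0
      have hFx : x = fun i => F (ε i.1) := by
        ext i
        simp only [F, Equiv.symm_apply_apply, dif_pos i.2]
      rw [mem_kerZ_iff, hFx] at hx
      obtain ⟨k, hk⟩ := exists_eq_mul_edgeCoeff hσ (hcol j) (F := F) fun y hy => by
        rw [← hx ⟨y, hy⟩]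
        exact (incidenceMatrix_restrictTo_mulVec ε _ F ⟨y, hy⟩).symm
      refine ⟨k, ?_⟩
      rw [hFx]
      ext i
      have hi := (edge_inter_bouquetBasis_nonempty_iff hσ').1 i.2
      rw [hk _ hi, Pi.smul_apply, smul_eq_mul, happly, if_pos hi]
  · -- the petals come first in the numbering, and they have coefficient `1`
    obtain ⟨i, hi⟩ := hcol j
    obtain ⟨p, hp⟩ := exists_petal hi
    have hex : ∃ k, edgeCol (ε k) = j := ⟨ε.symm (.inl p), by simp [edgeCol, hp]⟩
    obtain ⟨k, hk, hmin⟩ : ∃ k, edgeCol (ε k) = j ∧ ∀ l < k, edgeCol (ε l) ≠ j := by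
      obtain ⟨k, hk, hmin⟩ := WellFounded.has_min (wellFounded_lt (α := Fin N))
        {k | edgeCol (ε k) = j} hex
      exact ⟨k, hk, fun l hl h => hmin l h hl⟩
    refine ⟨k, ?_, fun l hl => by rw [happly, if_neg (hmin l hl)]⟩
    have hle : k ≤ ε.symm (.inl p) := by
      by_contra! h
      exact hmin _ h (by simp [edgeCol, hp])
    have hleft := hε _ _ hle (by simp)
    rw [happly, if_pos hk]
    obtain ⟨p', hp'⟩ := Sum.isLeft_iff.1 hleft
    rw [hp']
    exact one_pos

end Numbering

end ToricHypergraph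

open ToricHypergraph
/-- For every integer matrix `A` (with at least one column) without zero rows or columns there are
an almost 3-uniform hypergraph `H` with edges `E 1, …, E N`, vertices `v 1, …, v m` of `H`, and
vertex sets `U 1, …, U n`, such that `H` is built from sunflowers with matched petals, the edge
set is partitioned into bouquets with bases `U j`, whose encoding vectors are `c j` and `(a_j, 0)`,
and `B(u) = ∑ u_j c_j` has the stated properties. -/
theorem theorem3p2 {m n : ℕ} (hn : 0 < n) (A : Matrix (Fin m) (Fin n) ℤ)
    (hrow : ∀ i, ∃ j, A i j ≠ 0) (hcol : ∀ j, ∃ i, A i j ≠ 0) :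
    ∃ (V : Type) (_ : Finite V) (H : Hypergraph V) (N : ℕ) (E : Fin N ≃ H.edgeSet)
      (v : Fin m → V) (U : Fin n → Set V) (c : Fin n → Fin N → ℤ),
      H.vertexSet = Set.univ ∧
      IsAlmostThreeUniform H ∧
      -- `H` is built from sunflowers with matched petals
      Function.Injective v ∧
      IsBuiltFromMatchedSunflowers A H v U ∧
      -- the edges are partitioned into bouquets with bases, which have encoding vectors `c j`
      (∀ i, ∃! j, ((E i : Set V) ∩ U j).Nonempty) ∧
      (∀ (K : Type*) [Field K], ∀ j,
        IsBouquetWithBasis K (fun i => (E i : Set V)) (U j) (c j)) ∧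
      -- the vector `∑ i, (c j i) α_{E i}` is the `j`-th column of `A`, extended by zeros
      (∀ j, (∀ i, (incidenceMatrix (fun i => (E i : Set V)) *ᵥ c j) (v i) = A i j) ∧
        ∀ x, x ∉ Set.range v → (incidenceMatrix (fun i => (E i : Set V)) *ᵥ c j) x = 0) ∧
      -- (1) the bijections
      Set.BijOn (bouquetMap c) (kerZ A) (kerZ (incidenceMatrix fun i => (E i : Set V))) ∧
      Set.BijOn (bouquetMap c) (graverBasis A)
        (graverBasis (incidenceMatrix fun i => (E i : Set V))) ∧
      Set.BijOn (bouquetMap c) (circuits A)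
        (circuits (incidenceMatrix fun i => (E i : Set V))) ∧
      -- (2) the 1-norm does not decrease
      (∀ u ∈ kerZ A, ∑ j, |u j| ≤ ∑ i, |bouquetMap c u i|) ∧
      -- (3) strong robustness
      (∀ (K : Type*) [Field K],
        IsStronglyRobust K (incidenceMatrix fun i => (E i : Set V))) := by
  obtain ⟨σ, hσ⟩ := exists_perm_sameCycle_iff fun p : Petal A => p.1.2
  obtain ⟨N, ε, hε⟩ := exists_fin_equiv_sum (Petal A) (Petal A ⊕ NegEntry A)
  have hσ' : ∀ p, (σ p).1.2 = p.1.2 := col_apply_eq hσ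
  have hB := isBlockLift ε hσ hcol
  have hmap : bouquetMap (encodingVector ε) = blockLift (edgeCol ∘ ε) (edgeCoeff ∘ ε) :=
    funext (bouquetMap_encodingVector ε)
  refine ⟨Vertex A, inferInstance, sunflowerHypergraph σ, N,
    ε.trans (Equiv.ofInjective (edge σ) (edge_injective σ)), Vertex.row, bouquetBasis A,
    encodingVector ε, rfl, ?_, row_injective, isBuiltFromMatchedSunflowers hσ hcol, ?_,
    fun K _ j => isBouquetWithBasis ε K hσ hcol hε j, ?_, ?_, ?_, ?_, ?_,
    fun K _ => hB.hasTwoElementFibres.isStronglyRobust K⟩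
  · obtain ⟨i, hi⟩ := hcol ⟨0, hn⟩
    exact isAlmostThreeUniform_sunflowerHypergraph ⟨i, _, hi⟩
  · intro i
    exact ⟨edgeCol (ε i), (edge_inter_bouquetBasis_nonempty_iff hσ').2 rfl,
      fun j hj => ((edge_inter_bouquetBasis_nonempty_iff hσ').1 hj).symm⟩
  · intro j
    have hdeg := weightedDegree_blockLift hσ' (Pi.single j (1 : ℤ))
    constructor
    · intro i
      refine (incidenceMatrix_mulVec ε _ _).trans ((hdeg.2 i).trans ?_)
      simp
    · intro x hx
      refine (incidenceMatrix_mulVec ε _ _).trans (hdeg.1 x fun h => hx ?_)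
      rcases x with i | q | ⟨p, b⟩
      · exact ⟨i, rfl⟩
      · simp [vertexCol] at h
      · simp [vertexCol] at h
  · rw [hmap]
    exact hB.bijOn_kerZ
  · rw [hmap]
    exact hB.bijOn_graverBasis
  · rw [hmap]
    exact hB.bijOn_circuits
  · intro u _
    rw [hmap]
    exact hB.sum_abs_le u
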